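/- For $0<q<1$ and $\operatorname{Re} z>0$ let $$\Gamma(z:q)=(1-q)^{1-z}\,\frac{(q:q)_\infty}{(q^z:q)_\infty},\qquad (q^z:q)_\infty=\prod_{r=0}^\infty(1-q^{z+r}),$$ and let $\Gamma(z:1)=\Gamma(z)$. For $0<q\le 1$ let $\log\Gamma(z:q)$ denote the holomorphic logarithm of $\Gamma(z:q)$ on $\operatorname{Re} z>0$ that is real for $z>0$. Let the polynomials $P_k(x)$ ($k\ge1$) be given by $P_1(x)=1$ and $P_{k+1}(x)=(x-x^2)P_k'(x)+kx\,P_k(x)$, let $B_{2k}$ be the Bernoulli numbers, $\overline B_2(t)=B_2(t-\lfloor t\rfloor)$ with $B_2(t)=t^2-t+\frac16$, and put $$C_1(q)=-\frac1{12}\log q-\frac1{12}\,\frac{\log q}{q-1}+\int_0^\infty\frac{\overline B_2(t)}2\left(\frac{\log q}{q^{t+1}-1}\right)^2q^{t+1}\,dt .$$ For $m\ge1$ put $$S_m(z,q)=\Big(z-\tfrac12\Big)\log\frac{1-q^z}{1-q}+\log q\int_1^z\xi\,\frac{q^\xi}{1-q^\xi}\,d\xi+C_1(q)+\frac1{12}\log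 q+\sum_{k=1}^m\frac{B_{2k}}{(2k)!}\left(\frac{\log q}{q^z-1}\right)^{2k-1}P_{2k-1}(q^z),$$ with the principal logarithm and the integral taken along the segment from $1$ to $z$; for $q=1$ every term is replaced by its limit as $q\to1-0$. Theorem. (1) For each $0<q\le1$ the function $\log\Gamma(z:q)$ on $\operatorname{Re}z>0$ exists, and as $\operatorname{Re} z\to+\infty$ it has the asymptotic expansion given by the sums $S_m(z,q)$, uniformly in $0<q\le 1$: for every $m\ge1$ there is a constant $A>0$, depending only on $m$, such that $$\bigl|\log\Gamma(z:q)-S_m(z,q)\bigr|\le\frac{A}{(\operatorname{Re}z)^{2m+1}}\qquad(0<q\le1,\ \operatorname{Re}z>0).$$ (2) At $q=1$ it coincides with Stirling's formula: for $\operatorname{Re}z>0$, as $q\to1-0$, $\Gamma(z:q)\to\Gamma(z)$, $$\Big(z-\tfrac12\Big)\log\frac{1-q^z}{1-q}\to\Big(z-\tfrac12\Big)\log z,\qquad \log q\int_1^z\xi\,\frac{q^\xi}{1-q^\xi}\,d\xi\to 1-z,$$ $$C_1(q)\to C_1(1)=-\frac1{12}+\int_0^\infty\frac{\overline B_2(t)}{2(t+1)^2}\,dt=\frac12\log(2\pi)-1,$$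 $$\frac{B_{2k}}{(2k)!}\left(\frac{\log q}{q^z-1}\right)^{2k-1}P_{2k-1}(q^z)\to\frac{B_{2k}}{2k(2k-1)z^{2k-1}}\quad(k\ge1),$$ so that $$S_m(z,1)=\Big(z-\tfrac12\Big)\log z-z+\frac12\log(2\pi)+\sum_{k=1}^m\frac{B_{2k}}{2k(2k-1)z^{2k-1}} .$$ -/

import Mathlib

open Set Filter Topology MeasureTheory Polynomial

noncomputable section

/-- The `q`-shifted factorial `(q^z : q)_∞ = ∏_{r ≥ 0} (1 - q^(z+r))`. -/
def qShiftedFactorial (q : ℝ) (z : ℂ) : ℂ :=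
  ∏' r : ℕ, (1 - (q : ℂ) ^ (z + r))

/-- The `q`-gamma function
`Γ(z:q) = (1-q)^(1-z) (q:q)_∞ / (q^z:q)_∞` for `0 < q < 1`, and `Γ(z:1) = Γ(z)`. -/
def qGamma (q : ℝ) (z : ℂ) : ℂ :=
  if q = 1 then Complex.Gamma z
  else ((1 - q : ℝ) : ℂ) ^ (1 - z) * qShiftedFactorial q 1 / qShiftedFactorial q z

/-- `ℓ` is (on the right half plane) the function `log Γ(z:q)`: the holomorphic logarithm of
`Γ(z:q)` on `Re z > 0` which is real on the positive real axis. These conditions determine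
`ℓ` uniquely on `Re z > 0`. -/
structure IsLogQGamma (q : ℝ) (ℓ : ℂ → ℂ) : Prop where
  holomorphic : DifferentiableOn ℂ ℓ {z : ℂ | 0 < z.re}
  exp_eq : ∀ z : ℂ, 0 < z.re → Complex.exp (ℓ z) = qGamma q z
  real_on_reals : ∀ x : ℝ, 0 < x → (ℓ (x : ℂ)).im = 0

/-- The polynomials `P_k(x;s)`: `P_0 = 1/s`, `P_1 = 1`, and
`P_{k+1} = (x - x^2) P_k' + (k x + s) P_k`. -/
def qStirlingPoly (s : ℂ) : ℕ → ℂ[X]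
  | 0 => C s⁻¹
  | 1 => 1
  | k + 2 =>
      (X - X ^ 2) * derivative (qStirlingPoly s (k + 1))
        + (C ((k + 1 : ℕ) : ℂ) * X + C s) * qStirlingPoly s (k + 1)

/-- The `q`-number `[z]_q = (1 - q^z) / (1 - q)`, with its limiting value `z` at `q = 1`. -/
def qNumber (q : ℝ) (z : ℂ) : ℂ :=
  if q = 1 then z else (1 - (q : ℂ) ^ z) / (1 - (q : ℂ))

/-- `log q / (q^z - 1)`, with its limiting value `1 / z` at `q = 1`. -/
def qLogRatio (q : ℝ) (z : ℂ) : ℂ :=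
  if q = 1 then 1 / z else ((Real.log q : ℝ) : ℂ) / ((q : ℂ) ^ z - 1)

/-- The integral of `f` along the straight segment from `a` to `b` in the complex plane. -/
def segmentIntegral (f : ℂ → ℂ) (a b : ℂ) : ℂ :=
  ∫ t in (0 : ℝ)..1, (b - a) * f (a + (t : ℂ) * (b - a))

/-- `log q * ∫_1^z ξ q^ξ / (1 - q^ξ) dξ`, with its limiting value `1 - z` at `q = 1`. -/
def qStirlingIntegral (q : ℝ) (z : ℂ) : ℂ :=
  if q = 1 then 1 - z
  else ((Real.log q : ℝ) : ℂ) *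
    segmentIntegral (fun ξ => ξ * ((q : ℂ) ^ ξ / (1 - (q : ℂ) ^ ξ))) 1 z

/-- The periodic Bernoulli function `B̄_n(t) = B_n(t - [t])`. -/
def periodicBernoulli (n : ℕ) (t : ℝ) : ℝ :=
  bernoulliFun n (Int.fract t)

/-- The constant
`C₁(q) = -(1/12) log q - (1/12) log q/(q-1) + ∫_0^∞ B̄₂(t)/2 (log q/(q^(t+1)-1))² q^(t+1) dt`,
where at `q = 1` the quotients `log q / (q-1)` and `log q / (q^(t+1)-1)` take their
limiting values `1` and `1 / (t+1)`. -/
def qStirlingConst (q : ℝ) : ℝ :=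
  if q = 1 then
    -(1 / 12) + ∫ t in Ioi (0 : ℝ), periodicBernoulli 2 t / 2 * (1 / (t + 1)) ^ 2
  else
    -(1 / 12) * Real.log q - 1 / 12 * (Real.log q / (q - 1))
      + ∫ t in Ioi (0 : ℝ),
          periodicBernoulli 2 t / 2 * (Real.log q / (q ^ (t + 1) - 1)) ^ 2 * q ^ (t + 1)

/-- The `k`-th term `B_{2k}/(2k)! (log q/(q^z-1))^(2k-1) P_{2k-1}(q^z)` of the expansion, where
`P_k(x) = P_k(x;0)`. -/
def qStirlingTerm (q : ℝ) (k : ℕ) (z : ℂ) : ℂ :=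
  ((bernoulli (2 * k) : ℚ) : ℂ) / ((2 * k).factorial : ℂ) * qLogRatio q z ^ (2 * k - 1)
    * (qStirlingPoly 0 (2 * k - 1)).eval ((q : ℂ) ^ z)

/-- The expansion of `log Γ(z:q)` truncated after the term `k = m`. -/
def qStirlingSum (q : ℝ) (m : ℕ) (z : ℂ) : ℂ :=
  (z - 1 / 2) * Complex.log (qNumber q z) + qStirlingIntegral q z
    + ((qStirlingConst q : ℝ) : ℂ) + 1 / 12 * ((Real.log q : ℝ) : ℂ)
    + ∑ k ∈ Finset.Icc 1 m, qStirlingTerm q k z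

/-- The classical Stirling expansion of `log Γ(z)` truncated after the term `k = m`. -/
def stirlingSum (m : ℕ) (z : ℂ) : ℂ :=
  (z - 1 / 2) * Complex.log z - z + 1 / 2 * ((Real.log (2 * Real.pi) : ℝ) : ℂ)
    + ∑ k ∈ Finset.Icc 1 m,
        ((bernoulli (2 * k) : ℚ) : ℂ) / (2 * k * (2 * k - 1) * z ^ (2 * k - 1))

end

/-! Write `[z]` for the `q`-number, `u = log q / (q^z - 1)`, `D_k = u^k P_k(q^z)` and `R_k(z) =
∫_0^∞ B̄_k(t)/k! D_k(z+t) dt`. The recursion for `P_k` is the product rule in disguise: `D_k' =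
-D_{k+1}`. Euler-Maclaurin summation of `log [z+r]` therefore suggests the candidate `L = S_1 - R_2`
(`qLogGamma`), and the proof shows that `L` is the required logarithm.

Integration by parts on unit cells gives `L(z+1) = L(z) + log [z]` (`qLogGamma_add_one`), and
`C_1(q)` is chosen so that `L(1) = 0`. The explicit form of `L` gives `L(z+N) - L(1+N) - (z-1) log
[1+N] → 0` (`tendsto_qLogGamma_sub`), which takes the place of log-convexity in a Bohr-Mollerup
argument. Together these yield Euler's product limit for `exp L`, which is `Γ(z:q)` both for `q < 1`
and for `q = 1` (`exp_qLogGamma`). A holomorphic logarithm that is real on the positive axis is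
unique, so every admissible `log Γ(z:q)` equals `L`.

Further integrations by parts turn `S_1 - R_2` into `S_m - R_{2m}`. The error bound then rests on
one estimate uniform in `q`, `|u|^k |q^z| ≤ 3 k! / (Re z)^k`, and on the divisibility of `P_k` by
`X` for `k ≥ 2`. The same estimate dominates the integrals as `q → 1`, and Stirling's formula for
`n!` identifies `C_1(1)`. -/

/-- `u ^ k * P_k(q ^ z)` with `u = log q / (q ^ z - 1)`: up to sign, the `k`-th derivative of
`log [z]_q`. -/
noncomputable def qStirlingDeriv (q : ℝ) (k : ℕ) (z : ℂ) : ℂ :=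
  qLogRatio q z ^ k * (qStirlingPoly 0 k).eval ((q : ℂ) ^ z)

/-! ### Derivatives of `[z]`, `u` and `u^k P_k(q^z)` -/

section Basic

variable {q : ℝ} {z : ℂ}

theorem norm_ofReal_cpow_lt_one (hq : 0 < q) (hq1 : q < 1) (hz : 0 < z.re) :
    ‖(q : ℂ) ^ z‖ < 1 := by
  rw [Complex.norm_cpow_eq_rpow_re_of_pos hq]
  exact Real.rpow_lt_one hq.le hq1 hz

theorem norm_ofReal_cpow_le_one (hq : 0 < q) (hq1 : q ≤ 1) (hz : 0 < z.re) :
    ‖(q : ℂ) ^ z‖ ≤ 1 := by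
  rw [Complex.norm_cpow_eq_rpow_re_of_pos hq]
  exact Real.rpow_le_one hq.le hq1 hz.le

theorem one_sub_cpow_re_pos (hq : 0 < q) (hq1 : q < 1) (hz : 0 < z.re) :
    0 < (1 - (q : ℂ) ^ z).re := by
  have h := (Complex.abs_re_le_norm _).trans_lt (norm_ofReal_cpow_lt_one hq hq1 hz)
  have := (abs_lt.1 h).2
  simp only [Complex.sub_re, Complex.one_re]
  linarith

theorem one_sub_cpow_ne_zero (hq : 0 < q) (hq1 : q < 1) (hz : 0 < z.re) :
    1 - (q : ℂ) ^ z ≠ 0 := fun h => by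
  have := one_sub_cpow_re_pos hq hq1 hz
  simp [h] at this

theorem cpow_sub_one_ne_zero (hq : 0 < q) (hq1 : q < 1) (hz : 0 < z.re) :
    (q : ℂ) ^ z - 1 ≠ 0 := by
  rw [← neg_sub]
  exact neg_ne_zero.2 (one_sub_cpow_ne_zero hq hq1 hz)

theorem qNumber_re_pos (hq : 0 < q) (hq1 : q ≤ 1) (hz : 0 < z.re) : 0 < (qNumber q z).re := by
  unfold qNumber
  split_ifs with h
  · exact hz
  · have hlt := lt_of_le_of_ne hq1 h
    rw [← Complex.ofReal_one, ← Complex.ofReal_sub, Complex.div_ofReal_re, Complex.ofReal_one]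
    exact div_pos (one_sub_cpow_re_pos hq hlt hz) (by linarith)

theorem qNumber_ne_zero (hq : 0 < q) (hq1 : q ≤ 1) (hz : 0 < z.re) : qNumber q z ≠ 0 := fun h => by
  have := qNumber_re_pos hq hq1 hz
  simp [h] at this

theorem qNumber_mem_slitPlane (hq : 0 < q) (hq1 : q ≤ 1) (hz : 0 < z.re) :
    qNumber q z ∈ Complex.slitPlane := Or.inl (qNumber_re_pos hq hq1 hz)

/-- Replacing `log q` by `u (q^z - 1)` lets later computations treat `q = 1` and `q < 1` by one
formula. -/
theorem log_eq_qLogRatio_mul (hq : 0 < q) (hq1 : q ≤ 1) (hz : 0 < z.re) :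
    ((Real.log q : ℝ) : ℂ) = qLogRatio q z * ((q : ℂ) ^ z - 1) := by
  unfold qLogRatio
  split_ifs with h
  · simp [h]
  · rw [div_mul_cancel₀ _ (cpow_sub_one_ne_zero hq (lt_of_le_of_ne hq1 h) hz)]

theorem hasDerivAt_ofReal_cpow (hq : 0 < q) :
    HasDerivAt (fun w : ℂ => (q : ℂ) ^ w) ((Real.log q : ℝ) * (q : ℂ) ^ z) z := by
  have hq' : (q : ℂ) ≠ 0 := by exact_mod_cast hq.ne'
  refine ((hasDerivAt_id' z).const_cpow (c := (q : ℂ)) (Or.inl hq')).congr_deriv ?_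
  rw [Complex.ofReal_log hq.le]; simp [mul_comm]

theorem hasDerivAt_qLogRatio (hq : 0 < q) (hq1 : q ≤ 1) (hz : 0 < z.re) :
    HasDerivAt (qLogRatio q) (-(qLogRatio q z ^ 2 * (q : ℂ) ^ z)) z := by
  have hz0 : z ≠ 0 := fun h => by simp [h] at hz
  by_cases h : q = 1
  · have e : qLogRatio q = fun w => w⁻¹ := by ext w; simp [qLogRatio, h]
    rw [e, h]
    refine (hasDerivAt_inv hz0).congr_deriv ?_
    simp
  · have hlt := lt_of_le_of_ne hq1 h
    have e : qLogRatio q = fun w => ((Real.log q : ℝ) : ℂ) / ((q : ℂ) ^ w - 1) := by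
      ext w; simp [qLogRatio, h]
    have hne := cpow_sub_one_ne_zero hq hlt hz
    rw [e]
    refine ((hasDerivAt_const z ((Real.log q : ℝ) : ℂ)).fun_div
      ((hasDerivAt_ofReal_cpow (z := z) hq).sub_const 1) hne).congr_deriv ?_
    field_simp
    ring

theorem hasDerivAt_qNumber (hq : 0 < q) (hq1 : q ≤ 1) (hz : 0 < z.re) :
    HasDerivAt (qNumber q) (qNumber q z * (qLogRatio q z * (q : ℂ) ^ z)) z := by
  have hz0 : z ≠ 0 := fun h => by simp [h] at hz
  by_cases h : q = 1
  · have e : qNumber q = fun w => w := by ext w; simp [qNumber, h]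
    rw [e, h]
    refine (hasDerivAt_id' z).congr_deriv ?_
    simp [qLogRatio, hz0]
  · have hlt := lt_of_le_of_ne hq1 h
    have e : qNumber q = fun w => (1 - (q : ℂ) ^ w) / (1 - (q : ℂ)) := by
      ext w; simp [qNumber, h]
    have hne := cpow_sub_one_ne_zero hq hlt hz
    have hne2 : 1 - (q : ℂ) ≠ 0 := sub_ne_zero.2 (by exact_mod_cast (Ne.symm h))
    -- The identity `log q = u (q^z - 1)` is solved for `u`, since `q^z - 1` is nonzero.
    rw [log_eq_qLogRatio_mul hq hq1 hz |> fun e => (by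
      rw [e, mul_div_cancel_right₀ _ hne] :
        qLogRatio q z = ((Real.log q : ℝ) : ℂ) / ((q : ℂ) ^ z - 1)), e]
    refine (((hasDerivAt_ofReal_cpow (z := z) hq).const_sub 1).div_const (1 - (q : ℂ))).congr_deriv ?_
    field_simp
    ring

theorem hasDerivAt_log_qNumber (hq : 0 < q) (hq1 : q ≤ 1) (hz : 0 < z.re) :
    HasDerivAt (fun w => Complex.log (qNumber q w)) (qLogRatio q z * (q : ℂ) ^ z) z := by
  refine ((hasDerivAt_qNumber hq hq1 hz).clog (qNumber_mem_slitPlane hq hq1 hz)).congr_deriv ?_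
  rw [mul_div_cancel_left₀ _ (qNumber_ne_zero hq hq1 hz)]

/-- With `X = q^z` one has `u' = -u² X` and `X' = u (X - 1) X`. The product rule then produces
`-u^(k+1)` times `(X - X²) P_k' + k X P_k`, the defining recursion at `s = 0`. -/
theorem hasDerivAt_qStirlingDeriv (hq : 0 < q) (hq1 : q ≤ 1) (hz : 0 < z.re) (k : ℕ) :
    HasDerivAt (qStirlingDeriv q (k + 1)) (-qStirlingDeriv q (k + 2) z) z := by
  have h1 := (hasDerivAt_qLogRatio hq hq1 hz).pow (k + 1)
  have h2 := ((qStirlingPoly 0 (k + 1)).hasDerivAt ((q : ℂ) ^ z)).comp z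
    (hasDerivAt_ofReal_cpow (z := z) hq)
  refine (h1.mul h2).congr_deriv ?_
  rw [log_eq_qLogRatio_mul hq hq1 hz]
  simp only [qStirlingDeriv, qStirlingPoly, Function.comp, Pi.pow_apply, eval_add, eval_mul,
    eval_sub, eval_X, eval_pow, eval_C]
  push_cast
  ring

theorem qStirlingDeriv_one : qStirlingDeriv q 1 z = qLogRatio q z := by
  simp [qStirlingDeriv, qStirlingPoly]

theorem qStirlingDeriv_two : qStirlingDeriv q 2 z = qLogRatio q z ^ 2 * (q : ℂ) ^ z := by
  simp [qStirlingDeriv, qStirlingPoly]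

/-- The derivative of `log [z]` is `u q^z`, which differs from `u P_1 = u` by `log q`. This is the
origin of the term `(1/12) log q` in `S_m`. -/
theorem qLogRatio_mul_cpow (hq : 0 < q) (hq1 : q ≤ 1) (hz : 0 < z.re) :
    qLogRatio q z * (q : ℂ) ^ z = qStirlingDeriv q 1 z + (Real.log q : ℝ) := by
  rw [qStirlingDeriv_one, log_eq_qLogRatio_mul hq hq1 hz]; ring

theorem qStirlingTerm_eq (k : ℕ) : qStirlingTerm q k z =
    ((bernoulli (2 * k) : ℚ) : ℂ) / ((2 * k).factorial : ℂ) * qStirlingDeriv q (2 * k - 1) z := by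
  rw [qStirlingTerm, qStirlingDeriv, mul_assoc]

/-! ### Estimates uniform in `0 < q ≤ 1` -/

theorem one_add_pow_mul_exp_neg_le (k : ℕ) {a : ℝ} (ha : 0 ≤ a) :
    (1 + a) ^ k * Real.exp (-a) ≤ 3 * k.factorial := by
  have h := Real.pow_div_factorial_le_exp (1 + a) (by linarith) k
  have hk : (0 : ℝ) < k.factorial := by exact_mod_cast k.factorial_pos
  rw [div_le_iff₀ hk] at h
  calc (1 + a) ^ k * Real.exp (-a) ≤ Real.exp (1 + a) * k.factorial * Real.exp (-a) := by gcongr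
    _ = Real.exp 1 * k.factorial := by
      rw [mul_right_comm, ← Real.exp_add]; congr 2; ring
    _ ≤ 3 * k.factorial := by
      gcongr
      linarith [Real.exp_one_lt_d9]

theorem norm_qLogRatio_le (hq : 0 < q) (hq1 : q ≤ 1) (hz : 0 < z.re) :
    ‖qLogRatio q z‖ ≤ (1 + -(Real.log q) * z.re) / z.re := by
  by_cases h : q = 1
  · simp only [h, qLogRatio, if_true, one_div, norm_inv, Real.log_one, neg_zero, zero_mul, add_zero]
    exact inv_anti₀ hz ((le_abs_self _).trans (Complex.abs_re_le_norm z))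
  · have hlt := lt_of_le_of_ne hq1 h
    simp only [qLogRatio, h, if_false, norm_div, Complex.norm_real]
    set a := -(Real.log q) * z.re with ha
    have hL : Real.log q < 0 := Real.log_neg hq hlt
    have ha0 : 0 < a := mul_pos (by linarith) hz
    have hX : ‖(q : ℂ) ^ z‖ = Real.exp (-a) := by
      rw [Complex.norm_cpow_eq_rpow_re_of_pos hq, Real.rpow_def_of_pos hq, ha]; congr 1; ring
    have hn : 1 - Real.exp (-a) ≤ ‖(q : ℂ) ^ z - 1‖ := by
      have := norm_sub_norm_le (1 : ℂ) ((q : ℂ) ^ z)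
      rw [hX, norm_one, norm_sub_rev] at this; exact this
    have he : Real.exp (-a) < 1 := Real.exp_zero ▸ Real.exp_lt_exp.2 (by linarith)
    have he2 : (1 + a) * Real.exp (-a) ≤ 1 := by
      rw [Real.exp_neg, ← div_eq_mul_inv, div_le_one (Real.exp_pos _)]
      linarith [Real.add_one_le_exp a]
    have hl : ‖Real.log q‖ = a / z.re := by
      rw [Real.norm_of_nonpos hL.le, ha, mul_div_cancel_right₀ _ hz.ne']
    rw [hl, div_div, div_le_div_iff₀ (by nlinarith) hz]
    -- `(1 + a)(1 - e^(-a)) = a + (1 - (1 + a) e^(-a)) ≥ a`.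
    have : a ≤ (1 + a) * ‖(q : ℂ) ^ z - 1‖ := by nlinarith
    nlinarith

/-- With `a = -log q · Re z`, the bound `|u| ≤ (1 + a) / Re z` alone degenerates as `q → 0`. A
single factor `|q^z| = e^(-a)` absorbs every power of `1 + a`, which gives uniformity in `q`. -/
theorem norm_qLogRatio_pow_mul_cpow_le (hq : 0 < q) (hq1 : q ≤ 1) (hz : 0 < z.re) (k : ℕ) :
    ‖qLogRatio q z‖ ^ k * ‖(q : ℂ) ^ z‖ ≤ 3 * k.factorial / z.re ^ k := by
  have hX : ‖(q : ℂ) ^ z‖ = Real.exp (-(-(Real.log q) * z.re)) := by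
    rw [Complex.norm_cpow_eq_rpow_re_of_pos hq, Real.rpow_def_of_pos hq]; congr 1; ring
  have ha : 0 ≤ -(Real.log q) * z.re :=
    mul_nonneg (by linarith [Real.log_nonpos hq.le hq1]) hz.le
  rw [hX]
  calc _ ≤ ((1 + -(Real.log q) * z.re) / z.re) ^ k * Real.exp (-(-(Real.log q) * z.re)) := by
        gcongr; exact norm_qLogRatio_le hq hq1 hz
    _ = ((1 + -(Real.log q) * z.re) ^ k * Real.exp (-(-(Real.log q) * z.re))) / z.re ^ k := by
        rw [div_pow]; ring
    _ ≤ _ := div_le_div_of_nonneg_right (one_add_pow_mul_exp_neg_le k ha) (by positivity)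

theorem norm_qLogRatio_mul_cpow_le (hq : 0 < q) (hq1 : q ≤ 1) (hz : 0 < z.re) :
    ‖qLogRatio q z * (q : ℂ) ^ z‖ ≤ 3 / z.re := by
  simpa using norm_qLogRatio_pow_mul_cpow_le hq hq1 hz 1

/-- At `s = 0` both summands of the recursion carry a factor `X`. This supplies the factor `q^z`
needed for uniform decay; it fails for `P_1 = 1`, so the estimates start at index two. -/
theorem X_dvd_qStirlingPoly (k : ℕ) : X ∣ qStirlingPoly 0 (k + 2) := by
  rw [qStirlingPoly]
  simp only [map_zero, add_zero]
  refine dvd_add (Dvd.dvd.mul_right ?_ _) (Dvd.dvd.mul_right (Dvd.intro_left _ rfl) _)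
  exact dvd_sub dvd_rfl (dvd_pow_self _ two_ne_zero)

theorem exists_norm_qStirlingDeriv_le (k : ℕ) : ∃ C : ℝ, 0 < C ∧ ∀ (q : ℝ) (z : ℂ),
    0 < q → q ≤ 1 → 0 < z.re → ‖qStirlingDeriv q (k + 2) z‖ ≤ C / z.re ^ (k + 2) := by
  obtain ⟨Q, hQ⟩ := X_dvd_qStirlingPoly k
  obtain ⟨M, hM⟩ := (isCompact_closedBall (0 : ℂ) 1).exists_bound_of_continuousOn
    Q.continuous.continuousOn
  refine ⟨3 * (k + 2).factorial * (|M| + 1), by positivity, fun q z hq hq1 hz => ?_⟩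
  have h1 := hM ((q : ℂ) ^ z) (by simpa using norm_ofReal_cpow_le_one hq hq1 hz)
  have h2 := norm_qLogRatio_pow_mul_cpow_le hq hq1 hz (k + 2)
  rw [qStirlingDeriv, hQ, eval_mul, eval_X, norm_mul, norm_mul, norm_pow, ← mul_assoc]
  calc _ ≤ 3 * (k + 2).factorial / z.re ^ (k + 2) * (|M| + 1) := by
        gcongr
        linarith [le_abs_self M]
    _ = _ := by ring

/-! ### The segment integral as a primitive -/

theorem isOpen_re_pos : IsOpen {z : ℂ | 0 < z.re} := isOpen_lt continuous_const Complex.continuous_re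

theorem convex_re_pos : Convex ℝ {z : ℂ | 0 < z.re} := convex_halfSpace_re_gt 0

/-- A holomorphic function on a convex open set has a primitive `g`, and the fundamental theorem
along the segment gives `g z - g a`. -/
theorem hasDerivAt_segmentIntegral {f : ℂ → ℂ} {s : Set ℂ} (hs : Convex ℝ s) (hso : IsOpen s)
    (hf : DifferentiableOn ℂ f s) {a : ℂ} (ha : a ∈ s) (hz : z ∈ s) :
    HasDerivAt (segmentIntegral f a) (f z) z := by
  obtain ⟨g, hg⟩ := hs.exists_forall_hasDerivWithinAt hf
  have hg' : ∀ w ∈ s, HasDerivAt g (f w) w := fun w hw => (hg w hw).hasDerivAt (hso.mem_nhds hw)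
  have key : ∀ w ∈ s, segmentIntegral f a w = g w - g a := by
    intro w hw
    have hmem : ∀ t ∈ uIcc (0 : ℝ) 1, a + (t : ℂ) * (w - a) ∈ s := by
      intro t ht
      rw [uIcc_of_le zero_le_one] at ht
      have := hs.add_smul_sub_mem ha hw ht
      simpa using this
    have hpath : ∀ t : ℝ, HasDerivAt (fun t : ℝ => a + (t : ℂ) * (w - a)) (w - a) t := fun t => by
      simpa using ((Complex.ofRealCLM.hasDerivAt (x := t)).mul_const (w - a)).const_add a
    have := intervalIntegral.integral_eq_sub_of_hasDerivAt
      (f := fun t : ℝ => g (a + (t : ℂ) * (w - a)))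
      (f' := fun t : ℝ => (w - a) * f (a + (t : ℂ) * (w - a))) (a := 0) (b := 1)
      (fun t ht => by
        rw [mul_comm]
        exact (hg' _ (hmem t ht)).comp t (hpath t))
      (ContinuousOn.intervalIntegrable (continuousOn_const.mul
        (hf.continuousOn.comp (by fun_prop) hmem)))
    rw [segmentIntegral, this]
    simp
  have := (hg' z hz).sub_const (g a)
  refine this.congr_of_eventuallyEq ?_
  filter_upwards [hso.mem_nhds hz] with w hw using key w hw

theorem hasDerivAt_qStirlingIntegral (hq : 0 < q) (hq1 : q ≤ 1) (hz : 0 < z.re) :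
    HasDerivAt (qStirlingIntegral q) (-(z * (qLogRatio q z * (q : ℂ) ^ z))) z := by
  have hz0 : z ≠ 0 := fun h => by simp [h] at hz
  by_cases h : q = 1
  · have e : qStirlingIntegral q = fun w => 1 - w := by ext w; simp [qStirlingIntegral, h]
    rw [e, h]
    refine ((hasDerivAt_id' z).const_sub 1).congr_deriv ?_
    simp [qLogRatio, hz0]
  · have hlt := lt_of_le_of_ne hq1 h
    have e : qStirlingIntegral q = fun w => ((Real.log q : ℝ) : ℂ) *
      segmentIntegral (fun ξ => ξ * ((q : ℂ) ^ ξ / (1 - (q : ℂ) ^ ξ))) 1 w := by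
      ext w; simp [qStirlingIntegral, h]
    have hd : DifferentiableOn ℂ (fun ξ => ξ * ((q : ℂ) ^ ξ / (1 - (q : ℂ) ^ ξ)))
        {z : ℂ | 0 < z.re} := by
      intro w hw
      have hc := (hasDerivAt_ofReal_cpow (z := w) hq).differentiableAt
      exact (differentiableAt_id.mul (hc.div (hc.const_sub 1)
        (one_sub_cpow_ne_zero hq hlt hw))).differentiableWithinAt
    rw [e]
    refine ((hasDerivAt_segmentIntegral convex_re_pos isOpen_re_pos hd
      (a := 1) (by simp) hz).const_mul ((Real.log q : ℝ) : ℂ)).congr_deriv ?_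
    have := one_sub_cpow_ne_zero hq hlt hz
    rw [log_eq_qLogRatio_mul hq hq1 hz]
    field_simp
    ring

theorem qStirlingIntegral_one : qStirlingIntegral q 1 = 0 := by
  simp [qStirlingIntegral, segmentIntegral]

end Basic

/-! ### The remainder integral: bounds and holomorphy -/

/-- The remainder integral `∫_0^∞ B̄_k(t)/k! u^k P_k(q^(z+t)) dt`. -/
noncomputable def qStirlingRemainder (q : ℝ) (k : ℕ) (z : ℂ) : ℂ :=
  ∫ t in Ioi (0 : ℝ), ((periodicBernoulli k t / k.factorial : ℝ) : ℂ) * qStirlingDeriv q k (z + t)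

section Remainder

variable {q : ℝ} {z : ℂ}

theorem exists_abs_periodicBernoulli_le (k : ℕ) : ∃ B : ℝ, 0 < B ∧
    ∀ t, |periodicBernoulli k t / k.factorial| ≤ B := by
  obtain ⟨M, hM⟩ := (isCompact_Icc (a := (0 : ℝ)) (b := 1)).exists_bound_of_continuousOn
    (continuous_bernoulliFun k).continuousOn
  refine ⟨|M| + 1, by positivity, fun t => ?_⟩
  have h := hM (Int.fract t) ⟨Int.fract_nonneg t, (Int.fract_lt_one t).le⟩
  have hk : (1 : ℝ) ≤ k.factorial := by exact_mod_cast k.factorial_pos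
  rw [abs_div, abs_of_pos (by linarith : (0 : ℝ) < k.factorial)]
  calc _ ≤ |periodicBernoulli k t| := div_le_self (abs_nonneg _) hk
    _ ≤ _ := by
      rw [Real.norm_eq_abs] at h
      exact h.trans ((le_abs_self M).trans (by linarith))

theorem measurable_periodicBernoulli (k : ℕ) : Measurable (periodicBernoulli k) :=
  (continuous_bernoulliFun k).measurable.comp measurable_fract

theorem hasDerivAt_neg_inv_pow (k : ℕ) {σ t : ℝ} (h : σ + t ≠ 0) :
    HasDerivAt (fun t : ℝ => -((σ + t) ^ (k + 1))⁻¹ / (k + 1)) (1 / (σ + t) ^ (k + 2)) t := by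
  have h1 : HasDerivAt (fun t : ℝ => (σ + t) ^ (k + 1)) (((k + 1 : ℕ) : ℝ) * (σ + t) ^ k * 1) t :=
    ((hasDerivAt_id' t).const_add σ).pow (k + 1)
  refine (((h1.fun_inv (pow_ne_zero _ h)).neg).div_const _).congr_deriv ?_
  have : (k : ℝ) + 1 ≠ 0 := by positivity
  push_cast
  field_simp
  ring

theorem tendsto_neg_inv_pow (k : ℕ) (σ : ℝ) :
    Tendsto (fun t : ℝ => -((σ + t) ^ (k + 1))⁻¹ / (k + 1)) atTop (𝓝 0) := by
  have : Tendsto (fun t : ℝ => ((σ + t) ^ (k + 1))⁻¹) atTop (𝓝 0) :=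
    ((tendsto_pow_atTop (Nat.succ_ne_zero k)).comp
      (tendsto_atTop_add_const_left _ σ tendsto_id)).inv_tendsto_atTop
  simpa using this.neg.div_const ((k : ℝ) + 1)

theorem integrableOn_one_div_add_pow (k : ℕ) {σ : ℝ} (hσ : 0 < σ) :
    IntegrableOn (fun t : ℝ => 1 / (σ + t) ^ (k + 2)) (Ioi 0) := by
  refine integrableOn_Ioi_deriv_of_nonneg' (g := fun t : ℝ => -((σ + t) ^ (k + 1))⁻¹ / (k + 1))
    (fun t ht => hasDerivAt_neg_inv_pow k ?_) (fun t ht => ?_) (tendsto_neg_inv_pow k σ)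
  · have : (0 : ℝ) ≤ t := ht
    positivity
  · have : (0 : ℝ) < t := ht
    positivity

theorem integral_one_div_add_pow (k : ℕ) {σ : ℝ} (hσ : 0 < σ) :
    ∫ t in Ioi (0 : ℝ), 1 / (σ + t) ^ (k + 2) = 1 / ((k + 1) * σ ^ (k + 1)) := by
  rw [integral_Ioi_of_hasDerivAt_of_nonneg'
    (g := fun t : ℝ => -((σ + t) ^ (k + 1))⁻¹ / (k + 1))
    (fun t ht => hasDerivAt_neg_inv_pow k ?_) (fun t ht => ?_) (tendsto_neg_inv_pow k σ)]
  · simp; field_simp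
  · have : (0 : ℝ) ≤ t := ht
    positivity
  · have : (0 : ℝ) < t := ht
    positivity

theorem add_ofReal_re_pos (hz : 0 < z.re) {t : ℝ} (ht : 0 ≤ t) : 0 < (z + t).re := by
  simp; linarith

theorem hasDerivAt_add_ofReal (z : ℂ) (t : ℝ) : HasDerivAt (fun t : ℝ => z + (t : ℂ)) 1 t := by
  simpa using (Complex.ofRealCLM.hasDerivAt (x := t)).const_add z

theorem hasDerivAt_qStirlingDeriv_add (hq : 0 < q) (hq1 : q ≤ 1) (hz : 0 < z.re) (k : ℕ) {t : ℝ}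
    (ht : 0 ≤ t) : HasDerivAt (fun t : ℝ => qStirlingDeriv q (k + 1) (z + t))
      (-qStirlingDeriv q (k + 2) (z + t)) t := by
  exact ((hasDerivAt_qStirlingDeriv hq hq1 (add_ofReal_re_pos hz ht) k).comp t
    (hasDerivAt_add_ofReal z t)).congr_deriv (mul_one _)

theorem continuousOn_qStirlingDeriv_add (hq : 0 < q) (hq1 : q ≤ 1) (hz : 0 < z.re) (k : ℕ) :
    ContinuousOn (fun t : ℝ => qStirlingDeriv q (k + 1) (z + t)) (Ici 0) := fun _ ht =>
  (hasDerivAt_qStirlingDeriv_add hq hq1 hz k ht).continuousAt.continuousWithinAt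

theorem aestronglyMeasurable_qStirlingRemainder (hq : 0 < q) (hq1 : q ≤ 1) (hz : 0 < z.re)
    (j k : ℕ) : AEStronglyMeasurable (fun t : ℝ =>
      ((periodicBernoulli j t / j.factorial : ℝ) : ℂ) * qStirlingDeriv q (k + 1) (z + t))
      (volume.restrict (Ioi 0)) := by
  refine AEStronglyMeasurable.mul ?_ ?_
  · exact (Complex.measurable_ofReal.comp
      ((measurable_periodicBernoulli j).div_const _)).aestronglyMeasurable
  · exact ((continuousOn_qStirlingDeriv_add hq hq1 hz k).mono
      Ioi_subset_Ici_self).aestronglyMeasurable measurableSet_Ioi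

/-- A bound for the integrand of the remainder, uniform in `q`. -/
theorem exists_norm_qStirlingRemainder_integrand_le (j k : ℕ) : ∃ C : ℝ, 0 < C ∧
    ∀ (q : ℝ) (z : ℂ), 0 < q → q ≤ 1 → ∀ t : ℝ, 0 < z.re → 0 ≤ t →
      ‖((periodicBernoulli j t / j.factorial : ℝ) : ℂ) * qStirlingDeriv q (k + 2) (z + t)‖
        ≤ C * (1 / (z.re + t) ^ (k + 2)) := by
  obtain ⟨B, hB0, hB⟩ := exists_abs_periodicBernoulli_le j
  obtain ⟨C, hC0, hC⟩ := exists_norm_qStirlingDeriv_le k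
  refine ⟨B * C, by positivity, fun q z hq hq1 t hz ht => ?_⟩
  have h1 := hC q (z + t) hq hq1 (add_ofReal_re_pos hz ht)
  rw [norm_mul, Complex.norm_real, Real.norm_eq_abs]
  calc _ ≤ B * (C / (z + t : ℂ).re ^ (k + 2)) := by gcongr; exact hB t
    _ = _ := by simp; ring

theorem integrableOn_qStirlingRemainder (hq : 0 < q) (hq1 : q ≤ 1) (hz : 0 < z.re) (j k : ℕ) :
    IntegrableOn (fun t : ℝ =>
      ((periodicBernoulli j t / j.factorial : ℝ) : ℂ) * qStirlingDeriv q (k + 2) (z + t))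
      (Ioi 0) := by
  obtain ⟨C, -, hC⟩ := exists_norm_qStirlingRemainder_integrand_le j k
  refine Integrable.mono' ((integrableOn_one_div_add_pow k hz).const_mul C)
    (aestronglyMeasurable_qStirlingRemainder hq hq1 hz j (k + 1)) ?_
  filter_upwards [ae_restrict_mem measurableSet_Ioi] with t ht
  exact hC q z hq hq1 t hz (le_of_lt ht)

theorem exists_norm_qStirlingRemainder_le (k : ℕ) : ∃ C : ℝ, 0 < C ∧ ∀ (q : ℝ) (z : ℂ),
    0 < q → q ≤ 1 → 0 < z.re → ‖qStirlingRemainder q (k + 2) z‖ ≤ C / z.re ^ (k + 1) := by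
  obtain ⟨C, hC0, hC⟩ := exists_norm_qStirlingRemainder_integrand_le (k + 2) k
  refine ⟨C / (k + 1), by positivity, fun q z hq hq1 hz => ?_⟩
  calc _ ≤ ∫ t in Ioi (0 : ℝ), C * (1 / (z.re + t) ^ (k + 2)) := by
        refine norm_integral_le_of_norm_le ((integrableOn_one_div_add_pow k hz).const_mul C) ?_
        filter_upwards [ae_restrict_mem measurableSet_Ioi] with t ht
        exact hC q z hq hq1 t hz (le_of_lt ht)
    _ = _ := by
        rw [integral_const_mul, integral_one_div_add_pow k hz]; field_simp

/-- Differentiation under the integral: on the ball of radius `Re z / 2` real parts stay above `Re z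
/ 2`, so one integrable function dominates all the derivatives. -/
theorem hasDerivAt_qStirlingRemainder (hq : 0 < q) (hq1 : q ≤ 1) (hz : 0 < z.re) (k : ℕ) :
    HasDerivAt (qStirlingRemainder q (k + 2)) (∫ t in Ioi (0 : ℝ),
      ((periodicBernoulli (k + 2) t / (k + 2).factorial : ℝ) : ℂ) *
        -qStirlingDeriv q (k + 3) (z + t)) z := by
  obtain ⟨C, hC0, hC⟩ := exists_norm_qStirlingRemainder_integrand_le (k + 2) (k + 1)
  have hre : ∀ w ∈ Metric.ball z (z.re / 2), z.re / 2 < w.re := by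
    intro w hw
    have := (Complex.abs_re_le_norm (w - z)).trans_lt (by simpa [dist_eq_norm] using hw)
    rw [Complex.sub_re, abs_lt] at this
    linarith
  refine (hasDerivAt_integral_of_dominated_loc_of_deriv_le
    (μ := volume.restrict (Ioi (0 : ℝ)))
    (bound := fun t => C * (1 / (z.re / 2 + t) ^ (k + 3)))
    (F := fun w (t : ℝ) => ((periodicBernoulli (k + 2) t / (k + 2).factorial : ℝ) : ℂ) *
        qStirlingDeriv q (k + 2) (w + t))
    (F' := fun w (t : ℝ) => ((periodicBernoulli (k + 2) t / (k + 2).factorial : ℝ) : ℂ) *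
        -qStirlingDeriv q (k + 3) (w + t))
    (Metric.ball_mem_nhds z (half_pos hz)) ?_
    (integrableOn_qStirlingRemainder hq hq1 hz (k + 2) k) ?_ ?_
    ((integrableOn_one_div_add_pow (k + 1) (half_pos hz)).const_mul C) ?_).2
  · filter_upwards [isOpen_re_pos.mem_nhds hz] with w hw
    exact aestronglyMeasurable_qStirlingRemainder hq hq1 hw (k + 2) (k + 1)
  · exact (aestronglyMeasurable_qStirlingRemainder hq hq1 hz (k + 2) (k + 2)).neg.congr
      (ae_of_all _ fun t => (mul_neg _ _).symm)
  · filter_upwards [ae_restrict_mem measurableSet_Ioi] with t ht w hw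
    have ht0 : 0 < t := ht
    have hw' := hre w hw
    rw [mul_neg, norm_neg]
    refine (hC q w hq hq1 t (by linarith) ht0.le).trans ?_
    gcongr
  · filter_upwards [ae_restrict_mem measurableSet_Ioi] with t ht w hw
    have ht0 : 0 < t := ht
    have hw' := hre w hw
    have h1 := hasDerivAt_qStirlingDeriv hq hq1
      (add_ofReal_re_pos (z := w) (by linarith) ht0.le) (k + 1)
    have h2 : HasDerivAt (fun w : ℂ => w + (t : ℂ)) 1 w := (hasDerivAt_id' w).add_const _
    simpa using (h1.comp w h2).const_mul
      (((periodicBernoulli (k + 2) t / (k + 2).factorial : ℝ) : ℂ))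

/-! ### Integration by parts on unit cells -/

theorem hasDerivAt_bernoulliFun_div_factorial (k : ℕ) (s : ℝ) :
    HasDerivAt (fun s => bernoulliFun (k + 1) s / (k + 1).factorial)
      (bernoulliFun k s / k.factorial) s := by
  refine ((hasDerivAt_bernoulliFun (k + 1) s).div_const _).congr_deriv ?_
  have : (k.factorial : ℝ) ≠ 0 := by exact_mod_cast k.factorial_ne_zero
  rw [Nat.factorial_succ, Nat.add_sub_cancel]
  push_cast
  field_simp

theorem periodicBernoulli_natCast_add (k n : ℕ) {s : ℝ} (h0 : 0 ≤ s) (h1 : s < 1) :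
    periodicBernoulli k (n + s) = bernoulliFun k s := by
  rw [periodicBernoulli, Int.fract_natCast_add, Int.fract_eq_self.2 ⟨h0, h1⟩]

theorem intervalIntegral_periodicBernoulli_mul (k n : ℕ) (f : ℝ → ℂ) :
    ∫ t in (n : ℝ)..(n + 1 : ℕ), ((periodicBernoulli k t / k.factorial : ℝ) : ℂ) * f t =
      ∫ s in (0 : ℝ)..1, ((bernoulliFun k s / k.factorial : ℝ) : ℂ) * f (n + s) := by
  have := intervalIntegral.integral_comp_add_left (a := 0) (b := 1)
    (fun t => ((periodicBernoulli k t / k.factorial : ℝ) : ℂ) * f t) (n : ℝ)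
  rw [add_zero] at this
  rw [Nat.cast_succ, ← this]
  refine intervalIntegral.integral_congr_ae ?_
  -- At `s = 1` the fractional part jumps back to `0`, so this endpoint is discarded as a null set.
  have h1 : ∀ᵐ s : ℝ, s ≠ 1 := by simp [ae_iff]
  filter_upwards [h1] with s hs1 hs
  rw [uIoc_of_le zero_le_one] at hs
  rw [periodicBernoulli_natCast_add k n hs.1.le (lt_of_le_of_ne hs.2 hs1)]

/-- `B_{k+2}(t)/(k+2)!` is a primitive of `B_{k+1}(t)/(k+1)!` and takes the same value at `0` and
`1` because `k + 2 ≠ 1`; hence a single Bernoulli number multiplies both boundary values. -/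
theorem intervalIntegral_bernoulliFun_mul (hq : 0 < q) (hq1 : q ≤ 1) (hz : 0 < z.re) (k : ℕ) :
    ∫ s in (0 : ℝ)..1, ((bernoulliFun (k + 1) s / (k + 1).factorial : ℝ) : ℂ) *
      qStirlingDeriv q (k + 1) (z + s) =
    ((bernoulli (k + 2) : ℚ) : ℂ) / (k + 2).factorial *
      (qStirlingDeriv q (k + 1) (z + 1) - qStirlingDeriv q (k + 1) z) +
    ∫ s in (0 : ℝ)..1, ((bernoulliFun (k + 2) s / (k + 2).factorial : ℝ) : ℂ) *
      qStirlingDeriv q (k + 2) (z + s) := by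
  have hc : ∀ j, ContinuousOn (fun s : ℝ => qStirlingDeriv q (j + 1) (z + s)) (uIcc 0 1) :=
    fun j => (continuousOn_qStirlingDeriv_add hq hq1 hz j).mono (by
      rw [uIcc_of_le zero_le_one]; exact Icc_subset_Ici_self)
  have hb : ∀ j, Continuous fun s : ℝ => ((bernoulliFun j s / j.factorial : ℝ) : ℂ) := fun j =>
    Complex.continuous_ofReal.comp ((continuous_bernoulliFun j).div_const _)
  have key := intervalIntegral.integral_mul_deriv_eq_deriv_mul (a := 0) (b := 1)
    (u := fun s : ℝ => qStirlingDeriv q (k + 1) (z + s))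
    (u' := fun s : ℝ => -qStirlingDeriv q (k + 2) (z + s))
    (v := fun s : ℝ => ((bernoulliFun (k + 2) s / (k + 2).factorial : ℝ) : ℂ))
    (v' := fun s : ℝ => ((bernoulliFun (k + 1) s / (k + 1).factorial : ℝ) : ℂ))
    (fun t ht => hasDerivAt_qStirlingDeriv_add hq hq1 hz k (by
      rw [uIcc_of_le zero_le_one] at ht; exact ht.1))
    (fun t _ => (hasDerivAt_bernoulliFun_div_factorial (k + 1) t).ofReal_comp)
    ((hc (k + 1)).neg.intervalIntegrable) ((hb (k + 1)).intervalIntegrable _ _)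
  simp only [mul_comm _ (qStirlingDeriv q _ _)]
  rw [key, bernoulliFun_endpoints_eq_of_ne_one (by omega), bernoulliFun_eval_zero]
  simp only [neg_mul, intervalIntegral.integral_neg]
  push_cast
  simp
  ring

theorem tendsto_sum_qStirlingRemainder (hq : 0 < q) (hq1 : q ≤ 1) (hz : 0 < z.re) (j : ℕ) :
    Tendsto (fun n : ℕ => ∑ i ∈ Finset.range n,
      ∫ s in (0 : ℝ)..1, ((bernoulliFun (j + 2) s / (j + 2).factorial : ℝ) : ℂ) *
        qStirlingDeriv q (j + 2) (z + i + s)) atTop (𝓝 (qStirlingRemainder q (j + 2) z)) := by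
  have hint := integrableOn_qStirlingRemainder hq hq1 hz (j + 2) j
  refine (intervalIntegral_tendsto_integral_Ioi 0 hint tendsto_natCast_atTop_atTop).congr
    fun n => ?_
  have h := intervalIntegral.sum_integral_adjacent_intervals (μ := volume) (n := n)
    (a := fun i : ℕ => (i : ℝ)) (f := fun t : ℝ =>
      ((periodicBernoulli (j + 2) t / (j + 2).factorial : ℝ) : ℂ) *
        qStirlingDeriv q (j + 2) (z + t)) (fun i _ => by
      rw [intervalIntegrable_iff_integrableOn_Ioc_of_le (by push_cast; linarith)]
      exact hint.mono_set fun t ht => lt_of_le_of_lt (Nat.cast_nonneg i) ht.1)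
  rw [Nat.cast_zero] at h
  rw [← h]
  refine Finset.sum_congr rfl fun i _ => ?_
  rw [intervalIntegral_periodicBernoulli_mul (j + 2) i
    (fun t => qStirlingDeriv q (j + 2) (z + t))]
  push_cast
  simp only [add_assoc]

/-- Summing the cellwise integrations by parts, the boundary values telescope and `D_{k+2}(z+n) → 0`
leaves only the one at `z`. -/
theorem qStirlingRemainder_eq (hq : 0 < q) (hq1 : q ≤ 1) (hz : 0 < z.re) (k : ℕ) :
    qStirlingRemainder q (k + 2) z =
      -(((bernoulli (k + 3) : ℚ) : ℂ) / (k + 3).factorial * qStirlingDeriv q (k + 2) z) +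
        qStirlingRemainder q (k + 3) z := by
  have hlim := tendsto_sum_qStirlingRemainder hq hq1 hz
  have hT : Tendsto (fun n : ℕ => qStirlingDeriv q (k + 2) (z + n)) atTop (𝓝 0) := by
    obtain ⟨C, hC0, hC⟩ := exists_norm_qStirlingDeriv_le k
    have hlim0 : Tendsto (fun n : ℕ => C / (z.re + n) ^ (k + 2)) atTop (𝓝 0) :=
      ((tendsto_pow_atTop (Nat.succ_ne_zero (k + 1))).comp (tendsto_atTop_add_const_left _ z.re
        tendsto_natCast_atTop_atTop)).const_div_atTop C
    refine squeeze_zero_norm (fun n => ?_) hlim0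
    simpa using hC q (z + n) hq hq1 (by simp; positivity)
  have hs : ∀ n : ℕ, (∑ i ∈ Finset.range n,
      ∫ s in (0 : ℝ)..1, ((bernoulliFun (k + 2) s / (k + 2).factorial : ℝ) : ℂ) *
        qStirlingDeriv q (k + 2) (z + i + s)) =
      ((bernoulli (k + 3) : ℚ) : ℂ) / (k + 3).factorial *
        (qStirlingDeriv q (k + 2) (z + n) - qStirlingDeriv q (k + 2) z) +
      ∑ i ∈ Finset.range n,
        ∫ s in (0 : ℝ)..1, ((bernoulliFun (k + 1 + 2) s / (k + 1 + 2).factorial : ℝ) : ℂ) *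
          qStirlingDeriv q (k + 1 + 2) (z + i + s) := by
    intro n
    have htel := Finset.sum_range_sub (fun i : ℕ => qStirlingDeriv q (k + 2) (z + i)) n
    rw [Nat.cast_zero, add_zero] at htel
    rw [← htel, Finset.mul_sum, ← Finset.sum_add_distrib]
    refine Finset.sum_congr rfl fun i _ => ?_
    rw [intervalIntegral_bernoulliFun_mul hq hq1 (z := z + i) (by simp; positivity) (k + 1)]
    push_cast
    simp only [add_assoc]
  have := tendsto_nhds_unique (hlim k) ((((hT.sub_const _).const_mul _).add
    (hlim (k + 1))).congr fun n => (hs n).symm)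
  rw [this]
  ring

end Remainder

/-! ### The candidate logarithm and its expansion -/

/-- The logarithm of the `q`-gamma function as given by the Euler-Maclaurin formula. -/
noncomputable def qLogGamma (q : ℝ) (z : ℂ) : ℂ :=
  qStirlingSum q 1 z - qStirlingRemainder q 2 z

section LogGamma

variable {q : ℝ} {z : ℂ}

theorem qLogRatio_ofReal (hq : 0 < q) (x : ℝ) : qLogRatio q x =
    ((if q = 1 then 1 / x else Real.log q / (q ^ x - 1) : ℝ) : ℂ) := by
  unfold qLogRatio
  split_ifs <;> simp [Complex.ofReal_cpow hq.le]

theorem qStirlingDeriv_two_ofReal (hq : 0 < q) (x : ℝ) : qStirlingDeriv q 2 x =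
    (((if q = 1 then 1 / x else Real.log q / (q ^ x - 1)) ^ 2 * q ^ x : ℝ) : ℂ) := by
  rw [qStirlingDeriv_two, qLogRatio_ofReal hq]
  push_cast
  rw [Complex.ofReal_cpow hq.le]

theorem qStirlingRemainder_two_ofReal (hq : 0 < q) (x : ℝ) : qStirlingRemainder q 2 x =
    ((∫ t in Ioi (0 : ℝ), periodicBernoulli 2 t / 2 *
      ((if q = 1 then 1 / (x + t) else Real.log q / (q ^ (x + t) - 1)) ^ 2 *
        q ^ (x + t)) : ℝ) : ℂ) := by
  rw [← integral_complex_ofReal, qStirlingRemainder]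
  congr 1
  ext t
  rw [← Complex.ofReal_add, qStirlingDeriv_two_ofReal hq]
  push_cast
  simp

/-- The integral in `C_1(q)` is the remainder at `z = 1`; this form makes the normalisation `L(1) =
0` a cancellation. -/
theorem qStirlingConst_eq (hq : 0 < q) : ((qStirlingConst q : ℝ) : ℂ) =
    -(1 / 12) * (Real.log q : ℝ) - 1 / 12 * qLogRatio q 1 + qStirlingRemainder q 2 1 := by
  rw [← Complex.ofReal_one, qStirlingRemainder_two_ofReal hq, qLogRatio_ofReal hq]
  by_cases h : q = 1
  · simp [qStirlingConst, h, add_comm (1 : ℝ)]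
  · simp only [qStirlingConst, h, if_false, add_comm (1 : ℝ), mul_assoc]
    push_cast
    simp

theorem qLogGamma_eq : qLogGamma q z = (z - 1 / 2) * Complex.log (qNumber q z) +
    qStirlingIntegral q z + ((qStirlingConst q : ℝ) : ℂ) + 1 / 12 * ((Real.log q : ℝ) : ℂ) +
    1 / 12 * qStirlingDeriv q 1 z - qStirlingRemainder q 2 z := by
  simp only [qLogGamma, qStirlingSum, Finset.Icc_self, Finset.sum_singleton, qStirlingTerm_eq]
  norm_num [bernoulli_two, Nat.factorial]

theorem qNumber_one : qNumber q 1 = 1 := by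
  unfold qNumber
  split_ifs with h
  · rfl
  · rw [Complex.cpow_one, div_self (sub_ne_zero.2 (by exact_mod_cast (Ne.symm h)))]

theorem qLogGamma_one (hq : 0 < q) : qLogGamma q 1 = 0 := by
  rw [qLogGamma_eq, qStirlingConst_eq hq, qNumber_one, qStirlingIntegral_one, qStirlingDeriv_one]
  simp
  ring

/-- Each inductive step integrates by parts twice: the odd Bernoulli number vanishes and the even
one contributes the next term of the sum. -/
theorem qLogGamma_eq_sub_qStirlingRemainder (hq : 0 < q) (hq1 : q ≤ 1) (hz : 0 < z.re) (m : ℕ) :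
    qLogGamma q z = qStirlingSum q (m + 1) z - qStirlingRemainder q (2 * (m + 1)) z := by
  induction m with
  | zero => rfl
  | succ m ih =>
    have hb : _root_.bernoulli (2 * m + 3) = 0 :=
      bernoulli_eq_zero_of_odd ⟨m + 1, by ring⟩ (by omega)
    have h1 := qStirlingRemainder_eq hq hq1 hz (2 * m)
    have h2 := qStirlingRemainder_eq hq hq1 hz (2 * m + 1)
    rw [hb] at h1
    rw [ih, show 2 * (m + 1) = 2 * m + 2 by ring, h1, h2, qStirlingSum, qStirlingSum,
      Finset.sum_Icc_succ_top (by omega : 1 ≤ m + 1 + 1), qStirlingTerm_eq,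
      show 2 * (m + 1 + 1) = 2 * m + 1 + 3 by ring,
      show 2 * m + 1 + 3 - 1 = 2 * m + 1 + 2 by omega,
      show 2 * m + 1 + 3 = 2 * m + 4 by ring]
    simp
    ring

/-- The bound for `R_{2m+2}` falls two powers of `Re z` short. Expanding one term further replaces
it by that extra term and `R_{2m+4}`, both of the required order. -/
theorem exists_norm_qLogGamma_sub_qStirlingSum_le (m : ℕ) : ∃ A : ℝ, 0 < A ∧
    ∀ (q : ℝ) (z : ℂ), 0 < q → q ≤ 1 → 0 < z.re →
      ‖qLogGamma q z - qStirlingSum q (m + 1) z‖ ≤ A / z.re ^ (2 * (m + 1) + 1) := by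
  obtain ⟨C, hC0, hC⟩ := exists_norm_qStirlingDeriv_le (2 * m + 1)
  obtain ⟨D, hD0, hD⟩ := exists_norm_qStirlingRemainder_le (2 * m + 2)
  set b : ℂ := ((bernoulli (2 * m + 4) : ℚ) : ℂ) / (2 * m + 4).factorial with hb
  refine ⟨‖b‖ * C + D, by positivity, fun q z hq hq1 hz => ?_⟩
  have e : qLogGamma q z - qStirlingSum q (m + 1) z =
      b * qStirlingDeriv q (2 * m + 3) z - qStirlingRemainder q (2 * m + 4) z := by
    rw [qLogGamma_eq_sub_qStirlingRemainder hq hq1 hz (m + 1), qStirlingSum, qStirlingSum,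
      Finset.sum_Icc_succ_top (by omega : 1 ≤ m + 1 + 1), qStirlingTerm_eq,
      show 2 * (m + 1 + 1) = 2 * m + 4 by ring, show 2 * m + 4 - 1 = 2 * m + 3 by omega, ← hb]
    ring
  rw [e]
  calc _ ≤ ‖b‖ * ‖qStirlingDeriv q (2 * m + 3) z‖ + ‖qStirlingRemainder q (2 * m + 4) z‖ := by
        rw [← norm_mul]; exact norm_sub_le _ _
    _ ≤ ‖b‖ * (C / z.re ^ (2 * m + 3)) + D / z.re ^ (2 * m + 3) := by
        gcongr
        · exact hC q z hq hq1 hz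
        · exact hD q z hq hq1 hz
    _ = _ := by rw [show 2 * (m + 1) + 1 = 2 * m + 3 by ring]; ring

/-! ### Functional equation -/

theorem qStirlingRemainder_add_one (hq : 0 < q) (hq1 : q ≤ 1) (hz : 0 < z.re) (k : ℕ) :
    qStirlingRemainder q (k + 2) z = qStirlingRemainder q (k + 2) (z + 1) +
      ∫ s in (0 : ℝ)..1, ((bernoulliFun (k + 2) s / (k + 2).factorial : ℝ) : ℂ) *
        qStirlingDeriv q (k + 2) (z + s) := by
  have h1 := (tendsto_sum_qStirlingRemainder hq hq1 hz k).comp (tendsto_add_atTop_nat 1)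
  have h2 := tendsto_sum_qStirlingRemainder hq hq1 (z := z + 1) (by simp; linarith) k
  refine tendsto_nhds_unique h1 ((h2.add_const _).congr fun n => ?_)
  simp only [Function.comp]
  rw [Finset.sum_range_succ']
  simp only [Nat.cast_zero, add_zero, Nat.cast_succ]
  congr 1
  refine Finset.sum_congr rfl fun i _ => ?_
  simp only [add_assoc, add_comm (1 : ℂ) (i : ℂ)]

/-- The change in `R_2` is `∫_0^1 B_2(t)/2 · D_2(z+t) dt`. It is evaluated by integrating by parts
twice and using that `w log [w]` plus the Stirling integral is a primitive of `log [w]`. -/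
theorem qLogGamma_add_one (hq : 0 < q) (hq1 : q ≤ 1) (hz : 0 < z.re) :
    qLogGamma q (z + 1) = qLogGamma q z + Complex.log (qNumber q z) := by
  set h : ℝ → ℂ := fun t => Complex.log (qNumber q (z + t)) with hh
  have dh : ∀ t : ℝ, 0 ≤ t → HasDerivAt h (qStirlingDeriv q 1 (z + t) + (Real.log q : ℝ)) t := by
    intro t ht
    have hr := add_ofReal_re_pos hz ht
    refine ((hasDerivAt_log_qNumber hq hq1 hr).comp t (hasDerivAt_add_ofReal z t)).congr_deriv ?_
    rw [mul_one, qLogRatio_mul_cpow hq hq1 hr]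
  have dI : ∀ t : ℝ, 0 ≤ t → HasDerivAt (fun t : ℝ => qStirlingIntegral q (z + t))
      (-((z + t) * (qStirlingDeriv q 1 (z + t) + (Real.log q : ℝ)))) t := by
    intro t ht
    have hr := add_ofReal_re_pos hz ht
    refine ((hasDerivAt_qStirlingIntegral hq hq1 hr).comp t
      (hasDerivAt_add_ofReal z t)).congr_deriv ?_
    rw [mul_one, qLogRatio_mul_cpow hq hq1 hr]
  have dt : ∀ t : ℝ, HasDerivAt (fun t : ℝ => (t : ℂ)) 1 t := fun t =>
    Complex.ofRealCLM.hasDerivAt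
  have key := intervalIntegral.integral_eq_sub_of_hasDerivAt (a := 0) (b := 1)
    -- The explicit primitive is `-(B_2/2 · h' - B_1 · h + (z+t) h + I(z+t))`, with `I` the Stirling
    -- integral; in its derivative everything cancels except `B_2/2 · D_2`.
    (f := fun t : ℝ => -(((t : ℂ) * t - t + 1 / 6) / 2 *
        (qStirlingDeriv q 1 (z + t) + (Real.log q : ℝ)) - ((t : ℂ) - 1 / 2) * h t +
        (z + t) * h t + qStirlingIntegral q (z + t)))
    (f' := fun s : ℝ => ((bernoulliFun 2 s / Nat.factorial 2 : ℝ) : ℂ) *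
        qStirlingDeriv q 2 (z + s))
    (fun t ht => by
      rw [uIcc_of_le zero_le_one] at ht
      refine ((((((((dt t).fun_mul (dt t)).fun_sub (dt t)).add_const (1 / 6)).div_const 2).fun_mul
        ((hasDerivAt_qStirlingDeriv_add hq hq1 hz 0 ht.1).add_const ((Real.log q : ℝ) : ℂ))).fun_sub
        (((dt t).sub_const (1 / 2)).fun_mul (dh t ht.1))).fun_add
        ((hasDerivAt_add_ofReal z t).fun_mul (dh t ht.1))).fun_add
        (dI t ht.1) |>.fun_neg.congr_deriv ?_
      rw [bernoulliFun_two]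
      simp only [Nat.factorial]
      push_cast
      ring)
    (ContinuousOn.intervalIntegrable (ContinuousOn.mul
      (Complex.continuous_ofReal.comp ((continuous_bernoulliFun 2).div_const _)).continuousOn
      ((continuousOn_qStirlingDeriv_add hq hq1 hz 1).mono (by
        rw [uIcc_of_le zero_le_one]; exact Icc_subset_Ici_self))))
  have hJ := qStirlingRemainder_add_one hq hq1 hz 0
  simp only [zero_add] at hJ
  rw [qLogGamma_eq, qLogGamma_eq, hJ, key]
  simp only [hh, Complex.ofReal_zero, Complex.ofReal_one, add_zero]
  ring

theorem qLogGamma_add_natCast (hq : 0 < q) (hq1 : q ≤ 1) (hz : 0 < z.re) (N : ℕ) :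
    qLogGamma q (z + N) =
      qLogGamma q z + ∑ r ∈ Finset.range N, Complex.log (qNumber q (z + r)) := by
  induction N with
  | zero => simp
  | succ N ih =>
    rw [Finset.sum_range_succ, ← add_assoc, ← ih, Nat.cast_succ, ← add_assoc,
      qLogGamma_add_one hq hq1 (by simp; positivity)]

/-! ### Behaviour along `z + N` and the Euler product limit -/

theorem norm_log_qNumber_sub_le (hq : 0 < q) (hq1 : q ≤ 1) {σ : ℝ} (hσ : 0 < σ) {a b : ℂ}
    (ha : σ < a.re) (hb : σ < b.re) :
    ‖Complex.log (qNumber q b) - Complex.log (qNumber q a)‖ ≤ 3 / σ * ‖b - a‖ := by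
  refine (convex_halfSpace_re_gt σ).norm_image_sub_le_of_norm_hasDerivWithin_le
    (f := fun w => Complex.log (qNumber q w))
    (fun w hw => (hasDerivAt_log_qNumber hq hq1 (hσ.trans hw)).hasDerivWithinAt)
    (fun w hw => ?_) ha hb
  have hw' : σ < w.re := hw
  exact (norm_qLogRatio_mul_cpow_le hq hq1 (hσ.trans hw)).trans (by gcongr)

/-- A first-order Taylor estimate for a primitive of `log [w]`. The mean value inequality is applied
on a half-plane cut by the ball of radius `‖b - a‖`, where the derivative has changed by at most
`3/σ · ‖b - a‖`. -/
theorem norm_mul_log_qNumber_sub_le (hq : 0 < q) (hq1 : q ≤ 1) {σ : ℝ} (hσ : 0 < σ) {a b : ℂ}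
    (ha : σ < a.re) (hb : σ < b.re) :
    ‖(b * Complex.log (qNumber q b) + qStirlingIntegral q b) -
      (a * Complex.log (qNumber q a) + qStirlingIntegral q a) -
        (b - a) * Complex.log (qNumber q a)‖ ≤ 3 / σ * ‖b - a‖ ^ 2 := by
  have hs : Convex ℝ ({w : ℂ | σ < w.re} ∩ Metric.closedBall a ‖b - a‖) :=
    (convex_halfSpace_re_gt σ).inter (convex_closedBall _ _)
  have := hs.norm_image_sub_le_of_norm_hasDerivWithin_le (C := 3 / σ * ‖b - a‖)
    (f := fun w => (w * Complex.log (qNumber q w) + qStirlingIntegral q w) -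
      w * Complex.log (qNumber q a))
    (f' := fun w => Complex.log (qNumber q w) - Complex.log (qNumber q a))
    (fun w hw => by
      have hr : 0 < w.re := hσ.trans hw.1
      refine HasDerivAt.hasDerivWithinAt ((((hasDerivAt_id' w).fun_mul
        (hasDerivAt_log_qNumber hq hq1 hr)).fun_add
        (hasDerivAt_qStirlingIntegral hq hq1 hr)).fun_sub
        ((hasDerivAt_id' w).mul_const (Complex.log (qNumber q a))) |>.congr_deriv ?_)
      ring)
    (fun w hw => (norm_log_qNumber_sub_le hq hq1 hσ ha hw.1).trans (by
      have := mem_closedBall_iff_norm.1 hw.2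
      gcongr))
    (x := a) (y := b) ⟨ha, by simp⟩ ⟨hb, by simp [dist_eq_norm]⟩
  convert this using 1
  · congr 1; ring
  · ring

theorem tendsto_qLogGamma_sub (hq : 0 < q) (hq1 : q ≤ 1) (hz : 0 < z.re) :
    Tendsto (fun N : ℕ => qLogGamma q (z + N) - qLogGamma q (1 + N) -
      (z - 1) * Complex.log (qNumber q (1 + N))) atTop (𝓝 0) := by
  obtain ⟨C, hC0, hC⟩ := exists_norm_qStirlingRemainder_le 0
  -- The four numerators bound, in order, the Taylor error, the difference of logarithms, the two
  -- values of `u q^w`, and the two remainders.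
  have hlim : Tendsto (fun N : ℕ => (3 * ‖z - 1‖ ^ 2 + 3 * ‖z - 1‖ + 6 + (C + C)) / (N : ℝ))
      atTop (𝓝 0) := tendsto_natCast_atTop_atTop.const_div_atTop _
  refine squeeze_zero_norm' ?_ hlim
  filter_upwards [eventually_gt_atTop 0] with N hN
  have hN0 : (0 : ℝ) < N := by exact_mod_cast hN
  have ha : (N : ℝ) < (1 + N : ℂ).re := by simp
  have hb : (N : ℝ) < (z + N : ℂ).re := by simpa using hz
  have hba : (z + N : ℂ) - (1 + N) = z - 1 := by ring
  have h1 := norm_mul_log_qNumber_sub_le hq hq1 hN0 ha hb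
  have h2 := norm_log_qNumber_sub_le hq hq1 hN0 ha hb
  rw [hba] at h1 h2
  have h3 : ∀ w : ℂ, (N : ℝ) < w.re → ‖qLogRatio q w * (q : ℂ) ^ w‖ ≤ 3 / N := fun w hw =>
    (norm_qLogRatio_mul_cpow_le hq hq1 (hN0.trans hw)).trans (by gcongr)
  have h4 : ∀ w : ℂ, (N : ℝ) < w.re → ‖qStirlingRemainder q 2 w‖ ≤ C / N := fun w hw => by
    have := hC q w hq hq1 (hN0.trans hw)
    simp only [zero_add, pow_one] at this
    exact this.trans (by gcongr)
  have e : qLogGamma q (z + N) - qLogGamma q (1 + N) - (z - 1) * Complex.log (qNumber q (1 + N)) =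
      (((z + N) * Complex.log (qNumber q (z + N)) + qStirlingIntegral q (z + N)) -
      ((1 + N) * Complex.log (qNumber q (1 + N)) + qStirlingIntegral q (1 + N)) -
        (z - 1) * Complex.log (qNumber q (1 + N)))
      - 1 / 2 * (Complex.log (qNumber q (z + N)) - Complex.log (qNumber q (1 + N)))
      + 1 / 12 * (qLogRatio q (z + N) * (q : ℂ) ^ (z + N : ℂ)
        - qLogRatio q (1 + N) * (q : ℂ) ^ (1 + N : ℂ))
      - (qStirlingRemainder q 2 (z + N) - qStirlingRemainder q 2 (1 + N)) := by
    rw [qLogGamma_eq, qLogGamma_eq, qLogRatio_mul_cpow hq hq1 (hN0.trans ha),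
      qLogRatio_mul_cpow hq hq1 (hN0.trans hb)]
    ring
  have h5 := norm_sub_le (qLogRatio q (z + N) * (q : ℂ) ^ (z + N : ℂ))
    (qLogRatio q (1 + N) * (q : ℂ) ^ (1 + N : ℂ))
  have h6 := norm_sub_le (qStirlingRemainder q 2 (z + N)) (qStirlingRemainder q 2 (1 + N))
  have h7 := h3 _ ha
  have h8 := h3 _ hb
  have h9 := h4 _ ha
  have h10 := h4 _ hb
  rw [e]
  refine (norm_sub_le _ _).trans ?_
  refine (add_le_add_left ((norm_add_le _ _).trans
    (add_le_add_left (norm_sub_le _ _) _)) _).trans ?_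
  rw [norm_mul, norm_mul]
  norm_num only [norm_div, norm_one, Complex.norm_ofNat]
  have e2 : (3 * ‖z - 1‖ ^ 2 + 3 * ‖z - 1‖ + 6 + (C + C)) / (N : ℝ) =
    3 / N * ‖z - 1‖ ^ 2 + 3 / N * ‖z - 1‖ + (3 / N + 3 / N) + (C / N + C / N) := by ring
  rw [e2]
  have h11 := norm_nonneg (Complex.log (qNumber q (z + N)) - Complex.log (qNumber q (1 + N)))
  have h12 := norm_nonneg (qLogRatio q (z + N) * (q : ℂ) ^ (z + N : ℂ) -
    qLogRatio q (1 + N) * (q : ℂ) ^ (1 + N : ℂ))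
  linarith

/-- The functional equation carries `z` and `1` to `z + N` and `1 + N`, where the two values of `L`
are compared asymptotically; `L(1) = 0` removes the constant. -/
theorem tendsto_exp_qLogGamma (hq : 0 < q) (hq1 : q ≤ 1) (hz : 0 < z.re) :
    Tendsto (fun N : ℕ => Complex.exp ((z - 1) * Complex.log (qNumber q (1 + N))) *
      ∏ r ∈ Finset.range N, (qNumber q (1 + r) / qNumber q (z + r))) atTop
      (𝓝 (Complex.exp (qLogGamma q z))) := by
  have h := ((tendsto_qLogGamma_sub hq hq1 hz).const_sub (qLogGamma q z)).cexp
  rw [sub_zero] at h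
  refine h.congr fun N => ?_
  rw [qLogGamma_add_natCast hq hq1 hz, qLogGamma_add_natCast hq hq1 (by simp), qLogGamma_one hq]
  have e : ∀ r : ℕ, qNumber q (1 + r) / qNumber q (z + r) =
      Complex.exp (Complex.log (qNumber q (1 + r)) - Complex.log (qNumber q (z + r))) := fun r => by
    rw [Complex.exp_sub, Complex.exp_log (qNumber_ne_zero hq hq1 (by simp; positivity)),
      Complex.exp_log (qNumber_ne_zero hq hq1 (by simp; positivity))]
  simp only [e]
  rw [← Complex.exp_sum, ← Complex.exp_add, Finset.sum_sub_distrib]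
  congr 1
  ring

end LogGamma

/-! ### Identification with `Γ(z:q)` and uniqueness of the logarithm -/

section Existence

variable {q : ℝ} {z : ℂ}

theorem summable_norm_neg_cpow_add (hq : 0 < q) (hq1 : q < 1) (z : ℂ) :
    Summable fun r : ℕ => ‖-(q : ℂ) ^ (z + r)‖ := by
  have hq' : (q : ℂ) ≠ 0 := by exact_mod_cast hq.ne'
  have : ∀ r : ℕ, ‖-(q : ℂ) ^ (z + r)‖ = ‖(q : ℂ) ^ z‖ * q ^ r := fun r => by
    rw [norm_neg, Complex.cpow_add _ _ hq', Complex.cpow_natCast, norm_mul, norm_pow,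
      Complex.norm_of_nonneg hq.le]
  simp only [this]
  exact (summable_geometric_of_lt_one hq.le hq1).mul_left _

theorem tendsto_prod_qShiftedFactorial (hq : 0 < q) (hq1 : q < 1) (z : ℂ) :
    Tendsto (fun N : ℕ => ∏ r ∈ Finset.range N, (1 - (q : ℂ) ^ (z + r))) atTop
      (𝓝 (qShiftedFactorial q z)) := by
  have := (multipliable_one_add_of_summable (summable_norm_neg_cpow_add hq hq1 z)).hasProd
  simp only [← sub_eq_add_neg] at this
  exact this.tendsto_prod_nat

theorem qShiftedFactorial_ne_zero (hq : 0 < q) (hq1 : q < 1) (hz : 0 < z.re) :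
    qShiftedFactorial q z ≠ 0 := by
  have := tprod_one_add_ne_zero_of_summable (fun r : ℕ => by
    rw [← sub_eq_add_neg]
    exact one_sub_cpow_ne_zero hq hq1 (z := z + r) (by simp; positivity))
    (summable_norm_neg_cpow_add hq hq1 z)
  simpa only [qShiftedFactorial, ← sub_eq_add_neg] using this

/-- Since `[1+N] → 1/(1-q)`, the exponential prefactor tends to `(1-q)^(1-z)`. The denominators `1 -
q` cancel in the quotients, leaving the two shifted factorials. -/
theorem exp_qLogGamma_of_lt_one (hq : 0 < q) (hq1 : q < 1) (hz : 0 < z.re) :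
    Complex.exp (qLogGamma q z) = qGamma q z := by
  refine tendsto_nhds_unique (tendsto_exp_qLogGamma hq hq1.le hz) ?_
  have hq' : (q : ℂ) ≠ 0 := by exact_mod_cast hq.ne'
  have hne : 1 - (q : ℂ) ≠ 0 := sub_ne_zero.2 (by exact_mod_cast hq1.ne')
  have hpow : Tendsto (fun N : ℕ => (q : ℂ) ^ (1 + N : ℂ)) atTop (𝓝 0) := by
    have h1 : Tendsto (fun N : ℕ => (q : ℂ) ^ N) atTop (𝓝 0) :=
      tendsto_pow_atTop_nhds_zero_of_norm_lt_one (by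
        rwa [Complex.norm_of_nonneg hq.le])
    refine (by simpa using h1.const_mul (q : ℂ) : Tendsto _ _ _).congr fun N => ?_
    rw [Complex.cpow_add _ _ hq', Complex.cpow_natCast, Complex.cpow_one]
  have hnum : Tendsto (fun N : ℕ => qNumber q (1 + N)) atTop (𝓝 (((1 - q)⁻¹ : ℝ) : ℂ)) := by
    simp only [qNumber, hq1.ne, if_false]
    simpa using (hpow.const_sub 1).div_const (1 - (q : ℂ))
  have hexp := (((hnum.clog (Complex.ofReal_mem_slitPlane.2
    (inv_pos.2 (by linarith)))).const_mul (z - 1)).cexp)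
  have hprod := (tendsto_prod_qShiftedFactorial hq hq1 1).div
    (tendsto_prod_qShiftedFactorial hq hq1 z) (qShiftedFactorial_ne_zero hq hq1 hz)
  have e : qGamma q z = Complex.exp ((z - 1) * Complex.log (((1 - q)⁻¹ : ℝ) : ℂ)) *
      (qShiftedFactorial q 1 / qShiftedFactorial q z) := by
    rw [qGamma, if_neg hq1.ne, mul_div_assoc, Complex.cpow_def_of_ne_zero
      (by exact_mod_cast (sub_pos.2 hq1).ne'), ← Complex.ofReal_log (sub_pos.2 hq1).le,
      ← Complex.ofReal_log (inv_pos.2 (sub_pos.2 hq1)).le, Real.log_inv]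
    congr 2
    push_cast
    ring
  rw [e]
  refine (hexp.mul hprod).congr fun N => ?_
  simp only [Pi.div_apply, qNumber, hq1.ne, if_false, div_div_div_cancel_right₀ hne,
    Finset.prod_div_distrib]

theorem exp_qLogGamma_one_left (hz : 0 < z.re) :
    Complex.exp (qLogGamma 1 z) = qGamma 1 z := by
  refine tendsto_nhds_unique (tendsto_exp_qLogGamma one_pos le_rfl hz) ?_
  have h0 := tendsto_one_div_add_atTop_nhds_zero_nat (𝕜 := ℂ)
  -- This is the ratio of the product in question to `Complex.GammaSeq z (N + 1)`.
  have h1 : Tendsto (fun N : ℕ => (1 + (z - 1) * (1 / ((N : ℂ) + 1))) *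
      (1 + z * (1 / ((N : ℂ) + 1)))) atTop (𝓝 1) := by
    simpa using ((h0.const_mul (z - 1)).const_add 1).mul ((h0.const_mul z).const_add 1)
  have h2 := ((Complex.GammaSeq_tendsto_Gamma z).comp (tendsto_add_atTop_nat 1)).mul h1
  rw [mul_one] at h2
  rw [qGamma, if_pos rfl]
  refine h2.congr fun N => ?_
  have hN : (N : ℂ) + 1 ≠ 0 := Nat.cast_add_one_ne_zero N
  have hzr : ∀ r : ℕ, z + r ≠ 0 := fun r h => by
    have : 0 < (z + r).re := by simp; positivity
    simp [h] at this
  have hf : ∀ M : ℕ, ∏ r ∈ Finset.range M, (1 + (r : ℂ)) = M.factorial := fun M => by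
    rw [← Finset.prod_range_add_one_eq_factorial]
    push_cast
    exact Finset.prod_congr rfl fun _ _ => add_comm _ _
  have hp : ∏ r ∈ Finset.range N, (z + (r : ℂ)) ≠ 0 := Finset.prod_ne_zero_iff.2 fun r _ => hzr r
  have hz1 := hzr N
  have hz2 := hzr (N + 1)
  push_cast at hz2
  have hf0 : (N.factorial : ℂ) ≠ 0 := by exact_mod_cast N.factorial_ne_zero
  simp only [Function.comp, Complex.GammaSeq, qNumber, if_true, Finset.prod_div_distrib, hf]
  rw [Finset.prod_range_succ, Finset.prod_range_succ, Nat.factorial_succ]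
  push_cast
  rw [add_comm (1 : ℂ) N, mul_comm _ (Complex.log _), ← Complex.cpow_def_of_ne_zero hN,
    Complex.cpow_sub _ _ hN, Complex.cpow_one]
  field_simp
  ring

theorem exp_qLogGamma (hq : 0 < q) (hq1 : q ≤ 1) (hz : 0 < z.re) :
    Complex.exp (qLogGamma q z) = qGamma q z := by
  rcases hq1.eq_or_lt with rfl | h
  · exact exp_qLogGamma_one_left hz
  · exact exp_qLogGamma_of_lt_one hq h hz

theorem qNumber_ofReal (hq : 0 < q) (x : ℝ) :
    qNumber q x = ((if q = 1 then x else (1 - q ^ x) / (1 - q) : ℝ) : ℂ) := by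
  unfold qNumber
  split_ifs <;> simp [Complex.ofReal_cpow hq.le]

theorem qStirlingIntegral_ofReal (hq : 0 < q) (x : ℝ) :
    ∃ r : ℝ, qStirlingIntegral q x = r := by
  by_cases h : q = 1
  · exact ⟨1 - x, by simp [qStirlingIntegral, h]⟩
  · refine ⟨Real.log q * ∫ t in (0 : ℝ)..1, (x - 1) * ((1 + t * (x - 1)) *
      (q ^ (1 + t * (x - 1)) / (1 - q ^ (1 + t * (x - 1))))), ?_⟩
    rw [qStirlingIntegral, if_neg h, segmentIntegral, Complex.ofReal_mul,
      ← intervalIntegral.integral_ofReal]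
    push_cast [Complex.ofReal_cpow hq.le]
    rfl

theorem qLogGamma_ofReal (hq : 0 < q) (hq1 : q ≤ 1) {x : ℝ} (hx : 0 < x) :
    ∃ r : ℝ, qLogGamma q x = r := by
  have h1 := qNumber_re_pos hq hq1 (z := x) (by simpa using hx)
  obtain ⟨r, hr⟩ := qStirlingIntegral_ofReal hq x
  rw [qLogGamma_eq, hr, qStirlingDeriv_one, qLogRatio_ofReal hq, qStirlingRemainder_two_ofReal hq]
  rw [qNumber_ofReal hq] at h1 ⊢
  rw [Complex.ofReal_re] at h1
  rw [← Complex.ofReal_log h1.le]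
  exact ⟨(x - 1 / 2) * _ + r + qStirlingConst q + 1 / 12 * Real.log q + 1 / 12 * _ - _,
    by push_cast; rfl⟩

theorem differentiableAt_qLogGamma (hq : 0 < q) (hq1 : q ≤ 1) (hz : 0 < z.re) :
    DifferentiableAt ℂ (qLogGamma q) z := by
  have e : qLogGamma q = fun z => (z - 1 / 2) * Complex.log (qNumber q z) +
    qStirlingIntegral q z + ((qStirlingConst q : ℝ) : ℂ) + 1 / 12 * ((Real.log q : ℝ) : ℂ) +
    1 / 12 * qStirlingDeriv q 1 z - qStirlingRemainder q 2 z := funext fun z => qLogGamma_eq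
  have h1 := (hasDerivAt_log_qNumber hq hq1 hz).differentiableAt
  have h2 := (hasDerivAt_qStirlingIntegral hq hq1 hz).differentiableAt
  have h3 := (hasDerivAt_qStirlingDeriv hq hq1 hz 0).differentiableAt
  have h4 := (hasDerivAt_qStirlingRemainder hq hq1 hz 0).differentiableAt
  rw [e]
  simp only [zero_add] at h3 h4
  fun_prop

theorem isLogQGamma_qLogGamma (hq : 0 < q) (hq1 : q ≤ 1) : IsLogQGamma q (qLogGamma q) where
  holomorphic _ hz := (differentiableAt_qLogGamma hq hq1 hz).differentiableWithinAt
  exp_eq _ hz := exp_qLogGamma hq hq1 hz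
  real_on_reals x hx := by
    obtain ⟨r, hr⟩ := qLogGamma_ofReal hq hq1 hx
    rw [hr, Complex.ofReal_im]

/-- Equal exponentials force equal derivatives, so the difference is constant. At `1` the imaginary
parts vanish and the norms of the exponentials determine the real parts. -/
theorem IsLogQGamma.eqOn {ℓ₁ ℓ₂ : ℂ → ℂ} (h₁ : IsLogQGamma q ℓ₁) (h₂ : IsLogQGamma q ℓ₂) :
    EqOn ℓ₁ ℓ₂ {z : ℂ | 0 < z.re} := by
  have hexp : ∀ z : ℂ, 0 < z.re → Complex.exp (ℓ₁ z) = Complex.exp (ℓ₂ z) := fun z hz => by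
    rw [h₁.exp_eq z hz, h₂.exp_eq z hz]
  refine isOpen_re_pos.eqOn_of_deriv_eq convex_re_pos.isPreconnected h₁.holomorphic
    h₂.holomorphic (fun z hz => ?_) (x := 1) (by simp) ?_
  · have d₁ := (h₁.holomorphic.differentiableAt (isOpen_re_pos.mem_nhds hz)).hasDerivAt.cexp
    have d₂ := (h₂.holomorphic.differentiableAt (isOpen_re_pos.mem_nhds hz)).hasDerivAt.cexp
    have := d₁.unique (d₂.congr_of_eventuallyEq (by
      filter_upwards [isOpen_re_pos.mem_nhds hz] with w hw using hexp w hw))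
    rw [hexp z hz] at this
    exact mul_left_cancel₀ (Complex.exp_ne_zero _) this
  · have i₁ := h₁.real_on_reals 1 one_pos
    have i₂ := h₂.real_on_reals 1 one_pos
    rw [Complex.ofReal_one] at i₁ i₂
    refine Complex.ext ?_ (i₁.trans i₂.symm)
    have := congrArg norm (hexp 1 (by simp))
    rwa [Complex.norm_exp, Complex.norm_exp, Real.exp_eq_exp] at this

end Existence

/-! ### Passage to the limit `q → 1-` -/

section Limit

variable {z : ℂ}

theorem eventually_mem_Ioo_nhdsLT_one : ∀ᶠ q : ℝ in 𝓝[<] 1, 0 < q ∧ q < 1 := by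
  filter_upwards [Ioo_mem_nhdsLT (zero_lt_one' ℝ)] with q hq using hq

theorem tendsto_ofReal_cpow_one (z : ℂ) :
    Tendsto (fun q : ℝ => (q : ℂ) ^ z) (𝓝[<] 1) (𝓝 (((1 : ℝ) : ℂ) ^ z)) :=
  (((Complex.continuous_ofReal.tendsto 1).cpow tendsto_const_nhds (by simp)).mono_left
    nhdsWithin_le_nhds)

theorem tendsto_slope_cpow (z : ℂ) :
    Tendsto (fun q : ℝ => (1 - (q : ℂ) ^ z) / (1 - (q : ℂ))) (𝓝[<] 1) (𝓝 z) := by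
  have h := (hasDerivAt_id' (1 : ℂ)).cpow_const (c := z) (by simp)
  have h' : HasDerivAt (fun q : ℝ => (q : ℂ) ^ z) z 1 := by
    simpa using HasDerivAt.comp_ofReal (z := 1) (by simpa using h)
  refine ((hasDerivAt_iff_tendsto_slope.1 h').mono_left
    (nhdsWithin_mono _ fun x hx => ne_of_lt hx)).congr fun q => ?_
  rw [slope_def_module, Complex.real_smul]
  push_cast
  rw [Complex.one_cpow, ← neg_sub (q : ℂ), ← neg_sub ((q : ℂ) ^ z), neg_div_neg_eq,
    div_eq_inv_mul]

theorem tendsto_log_div_sub_one :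
    Tendsto (fun q : ℝ => Real.log q / (q - 1)) (𝓝[<] 1) (𝓝 1) := by
  have h := hasDerivAt_iff_tendsto_slope.1 (Real.hasDerivAt_log one_ne_zero)
  rw [inv_one] at h
  refine (h.mono_left (nhdsWithin_mono _ fun x hx => ne_of_lt hx)).congr fun q => ?_
  rw [slope_def_field, Real.log_one, sub_zero]

theorem tendsto_qNumber (z : ℂ) :
    Tendsto (fun q : ℝ => qNumber q z) (𝓝[<] 1) (𝓝 (qNumber 1 z)) := by
  rw [qNumber, if_pos rfl]
  refine (tendsto_slope_cpow z).congr' ?_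
  filter_upwards [eventually_mem_Ioo_nhdsLT_one] with q hq
  rw [qNumber, if_neg hq.2.ne]

theorem tendsto_log_qNumber (hz : 0 < z.re) :
    Tendsto (fun q : ℝ => Complex.log (qNumber q z)) (𝓝[<] 1)
      (𝓝 (Complex.log (qNumber 1 z))) :=
  (tendsto_qNumber z).clog (qNumber_mem_slitPlane one_pos le_rfl hz)

theorem tendsto_qLogRatio (hz : 0 < z.re) :
    Tendsto (fun q : ℝ => qLogRatio q z) (𝓝[<] 1) (𝓝 (qLogRatio 1 z)) := by
  have hz0 : z ≠ 0 := fun h => by simp [h] at hz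
  rw [qLogRatio, if_pos rfl]
  have h1 : Tendsto (fun q : ℝ => ((Real.log q / (q - 1) : ℝ) : ℂ)) (𝓝[<] 1) (𝓝 ((1 : ℝ) : ℂ)) :=
    (Complex.continuous_ofReal.tendsto 1).comp tendsto_log_div_sub_one
  have h2 := h1.div (tendsto_slope_cpow z) hz0
  rw [Complex.ofReal_one] at h2
  refine h2.congr' ?_
  filter_upwards [eventually_mem_Ioo_nhdsLT_one] with q hq
  have h3 := one_sub_cpow_ne_zero hq.1 hq.2 hz
  have h4 := cpow_sub_one_ne_zero hq.1 hq.2 hz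
  have h5 : (q : ℂ) - 1 ≠ 0 := sub_ne_zero.2 (by exact_mod_cast hq.2.ne)
  have h6 : 1 - (q : ℂ) ≠ 0 := sub_ne_zero.2 (by exact_mod_cast hq.2.ne')
  rw [Pi.div_apply, qLogRatio, if_neg hq.2.ne]
  push_cast
  field_simp
  ring

theorem tendsto_qStirlingDeriv (hz : 0 < z.re) (k : ℕ) :
    Tendsto (fun q : ℝ => qStirlingDeriv q k z) (𝓝[<] 1) (𝓝 (qStirlingDeriv 1 k z)) :=
  ((tendsto_qLogRatio hz).pow k).mul
    (((qStirlingPoly 0 k).continuous.tendsto _).comp (tendsto_ofReal_cpow_one z))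

theorem tendsto_qStirlingRemainder (hz : 0 < z.re) (k : ℕ) :
    Tendsto (fun q : ℝ => qStirlingRemainder q (k + 2) z) (𝓝[<] 1)
      (𝓝 (qStirlingRemainder 1 (k + 2) z)) := by
  obtain ⟨C, -, hC⟩ := exists_norm_qStirlingRemainder_integrand_le (k + 2) k
  refine tendsto_integral_filter_of_dominated_convergence _ ?_ ?_
    ((integrableOn_one_div_add_pow k hz).const_mul C) ?_
  · filter_upwards [eventually_mem_Ioo_nhdsLT_one] with q hq
    exact aestronglyMeasurable_qStirlingRemainder hq.1 hq.2.le hz (k + 2) (k + 1)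
  · filter_upwards [eventually_mem_Ioo_nhdsLT_one] with q hq
    filter_upwards [ae_restrict_mem measurableSet_Ioi] with t ht
    exact hC q z hq.1 hq.2.le t hz (le_of_lt ht)
  · filter_upwards [ae_restrict_mem measurableSet_Ioi] with t ht
    exact (tendsto_qStirlingDeriv (add_ofReal_re_pos hz (le_of_lt ht)) _).const_mul _

theorem tendsto_ofReal_log : Tendsto (fun q : ℝ => ((Real.log q : ℝ) : ℂ)) (𝓝[<] 1)
    (𝓝 ((Real.log 1 : ℝ) : ℂ)) :=
  (((Complex.continuous_ofReal.tendsto _).comp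
    (Real.continuousAt_log one_ne_zero).tendsto).mono_left nhdsWithin_le_nhds)

theorem tendsto_qStirlingConst : Tendsto qStirlingConst (𝓝[<] 1) (𝓝 (qStirlingConst 1)) := by
  have h1 : (0 : ℝ) < (1 : ℂ).re := by simp
  have h := ((tendsto_ofReal_log.const_mul (-(1 / 12))).sub
    ((tendsto_qLogRatio h1).const_mul (1 / 12))).add (tendsto_qStirlingRemainder h1 0)
  rw [zero_add, ← qStirlingConst_eq one_pos] at h
  refine ((Complex.continuous_re.tendsto _).comp h).congr' ?_
  filter_upwards [eventually_mem_Ioo_nhdsLT_one] with q hq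
  rw [Function.comp, ← qStirlingConst_eq hq.1, Complex.ofReal_re]

theorem one_add_mul_sub_one_re_pos (hz : 0 < z.re) {t : ℝ} (ht : t ∈ Icc (0 : ℝ) 1) :
    0 < (1 + (t : ℂ) * (z - 1)).re := by
  have := convex_re_pos.add_smul_sub_mem (x := 1) (y := z) (by simp) hz ht
  simpa using this

/-- Expressed through `u q^w`, the integrand has the same form at `q = 1` and is bounded uniformly
in `q`, as dominated convergence requires. -/
theorem qStirlingIntegral_eq {q : ℝ} (hz : 0 < z.re) :
    qStirlingIntegral q z = ∫ t in (0 : ℝ)..1, (z - 1) * -((1 + (t : ℂ) * (z - 1)) *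
      (qLogRatio q (1 + (t : ℂ) * (z - 1)) * (q : ℂ) ^ (1 + (t : ℂ) * (z - 1)))) := by
  by_cases h : q = 1
  · rw [qStirlingIntegral, if_pos h, intervalIntegral.integral_congr (g := fun _ => 1 - z)]
    · simp
    · intro t ht
      rw [uIcc_of_le zero_le_one] at ht
      have h0 : 1 + (t : ℂ) * (z - 1) ≠ 0 := fun h => by
        have := one_add_mul_sub_one_re_pos hz ht
        simp [h] at this
      simp [h, qLogRatio, h0]
  · rw [qStirlingIntegral, if_neg h, segmentIntegral, ← intervalIntegral.integral_const_mul]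
    congr 1
    ext t
    rw [qLogRatio, if_neg h, ← neg_sub 1 ((q : ℂ) ^ _), div_neg]
    ring

theorem tendsto_qStirlingIntegral (hz : 0 < z.re) :
    Tendsto (fun q : ℝ => qStirlingIntegral q z) (𝓝[<] 1) (𝓝 (qStirlingIntegral 1 z)) := by
  simp only [qStirlingIntegral_eq hz]
  have hpos : ∀ t ∈ uIoc (0 : ℝ) 1, 0 < (1 + (t : ℂ) * (z - 1)).re := fun t ht => by
    rw [uIoc_of_le zero_le_one] at ht
    exact one_add_mul_sub_one_re_pos hz (Ioc_subset_Icc_self ht)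
  have hpath : Continuous fun t : ℝ => 1 + (t : ℂ) * (z - 1) := by fun_prop
  refine intervalIntegral.tendsto_integral_filter_of_dominated_convergence
    (fun t => ‖z - 1‖ * (‖1 + (t : ℂ) * (z - 1)‖ * (3 / (1 + (t : ℂ) * (z - 1)).re))) ?_ ?_ ?_ ?_
  · filter_upwards [eventually_mem_Ioo_nhdsLT_one] with q hq
    refine ContinuousOn.aestronglyMeasurable ?_ measurableSet_uIoc
    refine continuousOn_const.mul ((hpath.continuousOn.mul (ContinuousOn.mul ?_ ?_)).neg)
    · exact fun t ht => (ContinuousAt.comp (f := fun t : ℝ => 1 + (t : ℂ) * (z - 1))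
        (hasDerivAt_qLogRatio hq.1 hq.2.le (hpos t ht)).continuousAt
        hpath.continuousAt).continuousWithinAt
    · exact fun t ht => (ContinuousAt.comp (f := fun t : ℝ => 1 + (t : ℂ) * (z - 1))
        (hasDerivAt_ofReal_cpow (q := q) hq.1).continuousAt
        hpath.continuousAt).continuousWithinAt
  · filter_upwards [eventually_mem_Ioo_nhdsLT_one] with q hq
    refine ae_of_all _ fun t ht => ?_
    rw [norm_mul, norm_neg, norm_mul]
    gcongr
    exact norm_qLogRatio_mul_cpow_le hq.1 hq.2.le (hpos t ht)
  · refine ContinuousOn.intervalIntegrable (continuousOn_const.mul (hpath.norm.continuousOn.mul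
      (continuousOn_const.div (Complex.continuous_re.comp hpath).continuousOn fun t ht => ?_)))
    rw [uIcc_of_le zero_le_one] at ht
    exact (one_add_mul_sub_one_re_pos hz ht).ne'
  · refine ae_of_all _ fun t ht => ?_
    exact ((((tendsto_qLogRatio (hpos t ht)).mul (tendsto_ofReal_cpow_one _)).const_mul _).neg
      ).const_mul _

theorem tendsto_qLogGamma (hz : 0 < z.re) :
    Tendsto (fun q : ℝ => qLogGamma q z) (𝓝[<] 1) (𝓝 (qLogGamma 1 z)) := by
  simp only [qLogGamma_eq]
  exact ((((((tendsto_log_qNumber hz).const_mul _).add (tendsto_qStirlingIntegral hz)).add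
    ((Complex.continuous_ofReal.tendsto _).comp tendsto_qStirlingConst)).add
    (tendsto_ofReal_log.const_mul _)).add ((tendsto_qStirlingDeriv hz 1).const_mul _)).sub
    (tendsto_qStirlingRemainder hz 0)

theorem tendsto_qStirlingTerm (hz : 0 < z.re) (k : ℕ) :
    Tendsto (fun q : ℝ => qStirlingTerm q k z) (𝓝[<] 1) (𝓝 (qStirlingTerm 1 k z)) := by
  simp only [qStirlingTerm_eq]
  exact (tendsto_qStirlingDeriv hz _).const_mul _

/-- At `X = 1` the factor `X - X²` kills the derivative term, so each step of the recursion only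
multiplies by its index. -/
theorem qStirlingPoly_zero_eval_one (k : ℕ) : (qStirlingPoly 0 (k + 1)).eval 1 = k.factorial := by
  induction k with
  | zero => simp [qStirlingPoly]
  | succ k ih =>
    rw [qStirlingPoly]
    simp [ih, Nat.factorial_succ]

theorem qStirlingTerm_one_left (z : ℂ) {k : ℕ} (hk : 1 ≤ k) : qStirlingTerm 1 k z =
    ((bernoulli (2 * k) : ℚ) : ℂ) / (2 * k * (2 * k - 1) * z ^ (2 * k - 1)) := by
  obtain ⟨m, rfl⟩ := Nat.exists_eq_add_of_le' hk
  have hf : ((2 * m).factorial : ℂ) ≠ 0 := by exact_mod_cast (2 * m).factorial_ne_zero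
  rw [qStirlingTerm_eq, qStirlingDeriv, show 2 * (m + 1) - 1 = 2 * m + 1 by omega,
    Complex.ofReal_one, Complex.one_cpow, qStirlingPoly_zero_eval_one, qLogRatio, if_pos rfl,
    show (2 * (m + 1)).factorial = (2 * m + 2) * ((2 * m + 1) * (2 * m).factorial) by
      rw [← Nat.factorial_succ, ← Nat.factorial_succ]; rfl]
  push_cast
  rw [show (2 : ℂ) * (m + 1) - 1 = 2 * m + 1 by ring, show (2 : ℂ) * (m + 1) = 2 * m + 2 by ring,
    one_div, inv_pow]
  field_simp

end Limit

/-! ### The constant at `q = 1` and the conclusion -/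

theorem log_stirlingSeq_eq {n : ℕ} (hn : 0 < n) : Real.log (Stirling.stirlingSeq n) =
    1 + qStirlingConst 1 - 1 / 2 * Real.log 2 +
      (1 / 12 * qStirlingDeriv 1 1 n - qStirlingRemainder 1 2 n).re := by
  have hn0 : (0 : ℝ) < n := by exact_mod_cast hn
  have hre : 0 < (n : ℂ).re := by simpa using hn0
  have h1 := exp_qLogGamma one_pos le_rfl (z := n + 1) (by simp; positivity)
  rw [qGamma, if_pos rfl, Complex.Gamma_nat_eq_factorial] at h1
  have h2 := congrArg norm h1
  rw [Complex.norm_exp, Complex.norm_natCast] at h2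
  have h3 := congrArg Real.log h2
  rw [Real.log_exp, qLogGamma_add_one one_pos le_rfl hre, qLogGamma_eq] at h3
  simp only [qNumber, if_true, qStirlingIntegral, Real.log_one, Complex.ofReal_zero, mul_zero,
    add_zero] at h3
  have h4 : Complex.log (n : ℂ) = ((Real.log n : ℝ) : ℂ) := by simp
  have h5 : ((n : ℂ) - 1 / 2) * ((Real.log n : ℝ) : ℂ) =
    ((((n : ℝ) - 1 / 2) * Real.log n : ℝ) : ℂ) := by push_cast; rfl
  rw [h4, h5, add_sub_assoc] at h3
  simp only [Complex.add_re, Complex.sub_re (1 : ℂ), Complex.ofReal_re, Complex.natCast_re,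
    Complex.one_re] at h3
  rw [Stirling.log_stirlingSeq_formula, ← h3, Real.log_mul two_ne_zero hn0.ne',
    Real.log_div hn0.ne' (Real.exp_ne_zero _), Real.log_exp]
  ring

/-- The Stirling sequence tends to `√π`, while `D_1(n)` and `R_2(n)` at `q = 1` tend to zero.
Comparing limits of logarithms gives `1 + C_1(1) - (log 2)/2 = (log π)/2`. -/
theorem qStirlingConst_one : qStirlingConst 1 = 1 / 2 * Real.log (2 * Real.pi) - 1 := by
  obtain ⟨C, -, hC⟩ := exists_norm_qStirlingRemainder_le 0
  have hnat : Tendsto (fun n : ℕ => (n : ℝ)) atTop atTop := tendsto_natCast_atTop_atTop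
  have hT : Tendsto (fun n : ℕ => qStirlingDeriv 1 1 n) atTop (𝓝 0) := by
    refine squeeze_zero_norm (fun n => ?_) (hnat.const_div_atTop 1)
    simp [qStirlingDeriv_one, qLogRatio]
  have hJ : Tendsto (fun n : ℕ => qStirlingRemainder 1 2 n) atTop (𝓝 0) := by
    refine squeeze_zero_norm' ?_ (hnat.const_div_atTop C)
    filter_upwards [eventually_gt_atTop 0] with n hn
    simpa using hC 1 n one_pos le_rfl (by simpa using hn)
  have h1 := ((Complex.continuous_re.tendsto _).comp
    ((hT.const_mul (1 / 12)).sub hJ)).const_add (1 + qStirlingConst 1 - 1 / 2 * Real.log 2)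
  have h2 := Stirling.tendsto_stirlingSeq_sqrt_pi.log (Real.sqrt_pos.2 Real.pi_pos).ne'
  have h3 := tendsto_nhds_unique h2 (h1.congr' (by
    filter_upwards [eventually_gt_atTop 0] with n hn
    exact (log_stirlingSeq_eq hn).symm))
  rw [Real.log_sqrt Real.pi_pos.le] at h3
  rw [Real.log_mul two_ne_zero Real.pi_pos.ne']
  simp at h3
  linarith

theorem qStirlingSum_one_left (m : ℕ) (z : ℂ) : qStirlingSum 1 m z = stirlingSum m z := by
  rw [qStirlingSum, stirlingSum, qStirlingConst_one, qNumber, if_pos rfl, qStirlingIntegral,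
    if_pos rfl, Finset.sum_congr rfl fun k hk => qStirlingTerm_one_left z (Finset.mem_Icc.1 hk).1]
  simp only [Real.log_one]
  push_cast
  ring

theorem mainTheorem6 :
    -- `log Γ(z:q)` exists as a holomorphic function on `Re z > 0`
    (∀ q : ℝ, 0 < q → q ≤ 1 → ∃ ℓ : ℂ → ℂ, IsLogQGamma q ℓ) ∧
    -- the asymptotic expansion as `Re z → +∞`, uniformly in `0 < q ≤ 1`
    (∀ m : ℕ, 1 ≤ m → ∃ A : ℝ, 0 < A ∧
      ∀ q : ℝ, 0 < q → q ≤ 1 → ∀ ℓ : ℂ → ℂ, IsLogQGamma q ℓ →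
        ∀ z : ℂ, 0 < z.re →
          ‖ℓ z - qStirlingSum q m z‖ ≤ A / z.re ^ (2 * m + 1)) ∧
    -- the objects at `q = 1` are the limits of those for `q < 1`, term by term
    (∀ z : ℂ, 0 < z.re →
      Tendsto (fun q : ℝ => qGamma q z) (𝓝[<] 1) (𝓝 (qGamma 1 z)) ∧
      Tendsto (fun q : ℝ => (z - 1 / 2) * Complex.log (qNumber q z)) (𝓝[<] 1)
        (𝓝 ((z - 1 / 2) * Complex.log (qNumber 1 z))) ∧
      Tendsto (fun q : ℝ => qStirlingIntegral q z) (𝓝[<] 1) (𝓝 (qStirlingIntegral 1 z)) ∧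
      Tendsto qStirlingConst (𝓝[<] 1) (𝓝 (qStirlingConst 1)) ∧
      ∀ k : ℕ, 1 ≤ k →
        Tendsto (fun q : ℝ => qStirlingTerm q k z) (𝓝[<] 1) (𝓝 (qStirlingTerm 1 k z))) ∧
    -- at `q = 1` the expansion is Stirling's formula for `log Γ(z)`, term by term
    qStirlingConst 1 = 1 / 2 * Real.log (2 * Real.pi) - 1 ∧
    (∀ z : ℂ, 0 < z.re →
      (∀ k : ℕ, 1 ≤ k → qStirlingTerm 1 k z =
        ((bernoulli (2 * k) : ℚ) : ℂ) / (2 * k * (2 * k - 1) * z ^ (2 * k - 1))) ∧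
      ∀ m : ℕ, qStirlingSum 1 m z = stirlingSum m z) := by
  refine ⟨fun q hq hq1 => ⟨_, isLogQGamma_qLogGamma hq hq1⟩, fun m hm => ?_, fun z hz => ?_,
    qStirlingConst_one, fun z _ => ⟨fun k hk => qStirlingTerm_one_left z hk,
      fun m => qStirlingSum_one_left m z⟩⟩
  · obtain ⟨n, rfl⟩ := Nat.exists_eq_add_of_le' hm
    obtain ⟨A, hA0, hA⟩ := exists_norm_qLogGamma_sub_qStirlingSum_le n
    refine ⟨A, hA0, fun q hq hq1 ℓ hℓ z hz => ?_⟩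
    rw [hℓ.eqOn (isLogQGamma_qLogGamma hq hq1) hz]
    exact hA q z hq hq1 hz
  · refine ⟨?_, (tendsto_log_qNumber hz).const_mul _, tendsto_qStirlingIntegral hz,
      tendsto_qStirlingConst, fun k _ => tendsto_qStirlingTerm hz k⟩
    -- Convergence of `Γ(z:q)` is obtained by exponentiating the convergence of `L`.
    rw [← exp_qLogGamma one_pos le_rfl hz]
    refine (tendsto_qLogGamma hz).cexp.congr' ?_
    filter_upwards [eventually_mem_Ioo_nhdsLT_one] with q hq
    exact exp_qLogGamma hq.1 hq.2.le hz
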